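/- Here a $\lambda$-ring means a commutative ring $R$ with operations $\lambda^n : R \to R$ ($n \ge 0$) such that $\lambda^0(x)=1$, $\lambda^1(x)=x$, $\lambda^n(x+y)=\sum_{i+j=n}\lambda^i(x)\lambda^j(y)$, $\lambda^n(1)=0$ for $n\ge 2$, and $$\lambda^n(xy)=P_n(\lambda^1 x,\dots,\lambda^n x;\lambda^1 y,\dots,\lambda^n y),\qquad \lambda^m(\lambda^n x)=P_{m,n}(\lambda^1x,\dots,\lambda^{mn}x),$$ where $P_n$ and $P_{m,n}$ are the unique integer polynomials such that $P_n(e_1(\xi),\dots,e_n(\xi);e_1(\eta),\dots,e_n(\eta))$ is the $n$-th elementary symmetric polynomial of the products $\xi_i\eta_j$ ($1\le i,j\le n$), and $P_{m,n}(e_1(\xi),\dots,e_{mn}(\xi))$ is the $m$-th elementary symmetric polynomial of the products $\xi_{i_1}\cdots\xi_{i_n}$ ($1\le i_1<\dots<i_n\le mn$). (These are the special $\lambda$-rings of the older terminology.) A homomorphism of $\lambda$-rings is a ring homomorphism commuting with all $\lambda^n$. For a symmetric function $f\in\Lambda=\mathbb{Z}[e_1,e_2,\dots]$ and $x\in R$,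 let $f(x)\in R$ be the image of $f$ under the ring homomorphism $\Lambda\to R$, $e_n\mapsto\lambda^n(x)$. An element $x\in R$ is called Schur-finite if there is a partition $\nu$ such that $s_\mu(x)=0$ for every partition $\mu$ whose Young diagram contains that of $\nu$, where $s_\mu$ is the Schur polynomial of $\mu$. An element $\ell$ is called a line element if $\lambda^n(\ell)=0$ for all $n>1$. For a commutative ring $A$, the big Witt ring $W(A)$ is the set $1+tA[[t]]$, with addition the multiplication of power series (so that zero is the series $1$), with unit $1+t$, with multiplication $$\Big(1+\sum_{n\ge1} a_nt^n\Big)*\Big(1+\sum_{n\ge1} b_nt^n\Big)=1+\sum_{n\ge1}P_n(a_1,\dots,a_n;b_1,\dots,b_n)t^n,$$ and with operations $\lambda^m\big(1+\sum_{n\ge1} a_nt^n\big)=1+\sum_{n\ge1}P_{n,m}(a_1,\dots,a_{nm})t^n$. **Proposition.** Let $R$ be a $\lambda$-ring that is an integral domain, and let $E$ be the algebraic closure of the fraction field of $R$. Then $R'=W(E)$ is a $\lambda$-ring, the map $\iota : R\to R'$, $x\mapsto \sum_{n\ge0}\lambda^n(x)t^n$, is an injective homomorphism of $\lambda$-rings,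 and for every Schur-finite element $x\in R$ there are $p,q\ge0$ and line elements $\ell_1,\dots,\ell_p,\ell'_1,\dots,\ell'_q$ of $R'$ such that $$\iota(x)=\sum_{i=1}^p\ell_i-\sum_{j=1}^q\ell'_j .$$ -/

import Mathlib

namespace LambdaTheory
open MvPolynomial

section UniversalPolynomials

theorem prod_one_add_mul {σ A : Type*} [CommRing A] (s : Finset σ) (v : σ → A) (t : A) :
    ∏ i ∈ s, (1 + v i * t) =
      ∑ k ∈ Finset.range (s.card + 1), (s.val.map v).esymm k * t ^ k := by
  classical
  rw [Finset.prod_one_add, Finset.sum_powerset]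
  refine Finset.sum_congr rfl fun k _ => ?_
  rw [Finset.esymm_map_val, Finset.sum_mul]
  refine Finset.sum_congr rfl fun u hu => ?_
  rw [Finset.prod_mul_distrib, Finset.prod_const, (Finset.mem_powersetCard.1 hu).2]

theorem esymm_eq_zero_of_card_lt {A : Type*} [CommRing A] (s : Multiset A) (n : ℕ)
    (h : s.card < n) : s.esymm n = 0 := by
  rw [Multiset.esymm, Multiset.powersetCard_eq_empty _ h]; simp

theorem coeff_prod_one_add {σ A : Type*} [CommRing A] (s : Finset σ) (v : σ → A) (n : ℕ) :
    (∏ i ∈ s, (1 + Polynomial.C (v i) * Polynomial.X : Polynomial A)).coeff n =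
      (s.val.map v).esymm n := by
  rw [prod_one_add_mul, Polynomial.finsetSum_coeff]
  have key : ∀ k, (s.val.map fun i => Polynomial.C (v i)).esymm k =
      Polynomial.C ((s.val.map v).esymm k) := by
    intro k
    simp [Finset.esymm_map_val, map_sum, map_prod]
  simp only [key, Polynomial.coeff_C_mul_X_pow]
  by_cases h : n ≤ s.card
  · rw [Finset.sum_eq_single n] <;> grind
  · rw [esymm_eq_zero_of_card_lt _ _ (by simpa using h)]
    refine Finset.sum_eq_zero fun k hk => ?_
    grind

/-- The `n`-th elementary symmetric polynomial of the products `x_i y_j`, `1 ≤ i, j ≤ n`. -/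
noncomputable def prodTarget (n : ℕ) : MvPolynomial (Fin n ⊕ Fin n) ℤ :=
  ((Finset.univ : Finset (Fin n × Fin n)).val.map
    (fun p => X (Sum.inl p.1) * X (Sum.inr p.2))).esymm n

/-- The elementary symmetric polynomials `e_1(x), …, e_n(x)` and `e_1(y), …, e_n(y)`
of two families `x_1, …, x_n` and `y_1, …, y_n`. -/
noncomputable def elemPair (n : ℕ) : Fin n ⊕ Fin n → MvPolynomial (Fin n ⊕ Fin n) ℤ :=
  Sum.elim (fun i => rename Sum.inl (esymm (Fin n) ℤ (i + 1)))
    (fun j => rename Sum.inr (esymm (Fin n) ℤ (j + 1)))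

theorem elemPair_algebraicIndependent (n : ℕ) : AlgebraicIndependent ℤ (elemPair n) := by
  have h1 : ∀ (B : Type) [CommRing B],
      AlgebraicIndependent B (fun i : Fin n => esymm (Fin n) B (i + 1)) := by
    intro B _ p q h
    apply esymmAlgHom_injective (σ := Fin n) B (n := n) (by simp)
    apply Subtype.ext
    rw [esymmAlgHom_apply, esymmAlgHom_apply]
    exact h
  have h2 := (h1 ℤ).sumElim_comp (A := MvPolynomial (Fin n) (MvPolynomial (Fin n) ℤ))
    (h1 (MvPolynomial (Fin n) ℤ))
  have h3 := h2.map' (f := (sumAlgEquiv ℤ (Fin n) (Fin n)).symm.toAlgHom)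
    (sumAlgEquiv ℤ (Fin n) (Fin n)).symm.injective
  convert h3 using 1
  funext i
  apply (sumAlgEquiv ℤ (Fin n) (Fin n)).injective
  rcases i with i | i
  · simp [elemPair, esymm, map_sum, map_prod]
  · simp [elemPair, esymm, map_sum, map_prod, algebraMap_eq]

theorem exists_prodPoly (n : ℕ) : ∃ P : MvPolynomial (Fin n ⊕ Fin n) ℤ,
    aeval (elemPair n) P = prodTarget n := by
  classical
  let b : ℕ → MvPolynomial (Fin n) ℤ := fun k =>
    if k = 0 then 1 else if h : k - 1 < n then X ⟨k - 1, h⟩ else 0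
  let q : MvPolynomial (Fin n) (MvPolynomial (Fin n) ℤ) :=
    (∏ i, (∑ k ∈ Finset.range (n + 1), Polynomial.C (C (b k) * X i ^ k) * Polynomial.X ^ k :
      Polynomial (MvPolynomial (Fin n) (MvPolynomial (Fin n) ℤ)))).coeff n
  have hq : q.IsSymmetric := by
    intro e
    change (rename e).toRingHom q = q
    simp only [q]
    rw [← Polynomial.coeff_map, Polynomial.map_prod]
    congr 1
    refine Fintype.prod_equiv e _ _ fun i => ?_
    simp [Polynomial.map_sum]
  let β : MvPolynomial (Fin n) ℤ →+* MvPolynomial (Fin n ⊕ Fin n) ℤ :=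
    (aeval fun j : Fin n => rename Sum.inr (esymm (Fin n) ℤ (j + 1))).toRingHom
  let ψ : MvPolynomial (Fin n) (MvPolynomial (Fin n) ℤ) →+* MvPolynomial (Fin n ⊕ Fin n) ℤ :=
    eval₂Hom β fun i => X (Sum.inl i)
  obtain ⟨q', hq'⟩ := esymmAlgHom_surjective (σ := Fin n) (MvPolynomial (Fin n) ℤ) (n := n)
    (by simp) ⟨q, hq⟩
  have hq'' : aeval (fun i : Fin n => esymm (Fin n) (MvPolynomial (Fin n) ℤ) (i + 1)) q' = q := by
    rw [← esymmAlgHom_apply, hq']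
  have hcomm : ∀ p, aeval (elemPair n) ((sumAlgEquiv ℤ (Fin n) (Fin n)).symm p) =
      ψ (aeval (fun i : Fin n => esymm (Fin n) (MvPolynomial (Fin n) ℤ) (i + 1)) p) := by
    intro p
    have : ((aeval (elemPair n)).toRingHom.comp
        (sumAlgEquiv ℤ (Fin n) (Fin n)).symm.toRingEquiv.toRingHom) = ψ.comp
        (aeval (fun i : Fin n => esymm (Fin n) (MvPolynomial (Fin n) ℤ) (i + 1))).toRingHom := by
      apply MvPolynomial.ringHom_ext'
      · apply MvPolynomial.ringHom_ext'
        · exact RingHom.ext_int _ _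
        · intro j
          simp [ψ, β, elemPair]
      · intro i
        simp [ψ, elemPair, esymm, map_sum, map_prod]
    exact congrArg (fun f => f p) this
  refine ⟨(sumAlgEquiv ℤ (Fin n) (Fin n)).symm q', ?_⟩
  rw [hcomm, hq'', prodTarget, ← coeff_prod_one_add]
  simp only [q]
  rw [← Polynomial.coeff_map, Polynomial.map_prod, ← Finset.univ_product_univ, Finset.prod_product]
  congr 1
  refine Finset.prod_congr rfl fun i _ => ?_
  have h1 := prod_one_add_mul (Finset.univ : Finset (Fin n))
    (fun j => (Polynomial.C (X (Sum.inr j)) : Polynomial (MvPolynomial (Fin n ⊕ Fin n) ℤ)))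
    (Polynomial.C (X (Sum.inl i)) * Polynomial.X)
  have h2 : ∀ j : Fin n, (1 + Polynomial.C (X (Sum.inl i) * X (Sum.inr j)) * Polynomial.X :
      Polynomial (MvPolynomial (Fin n ⊕ Fin n) ℤ)) = 1 + Polynomial.C (X (Sum.inr j)) *
        (Polynomial.C (X (Sum.inl i)) * Polynomial.X) := by
    intro j; rw [map_mul]; ring
  simp only [h2]
  rw [h1, Polynomial.map_sum]
  simp only [Finset.card_univ, Fintype.card_fin]
  refine Finset.sum_congr rfl fun k hk => ?_
  have h3 : β (b k) = (Finset.univ.val.map fun j : Fin n =>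
      (X (Sum.inr j) : MvPolynomial (Fin n ⊕ Fin n) ℤ)).esymm k := by
    by_cases hk0 : k = 0
    · subst hk0; simp [b, Multiset.esymm]
    · have hk1 : k - 1 < n := by grind
      have hk2 : k - 1 + 1 = k := by omega
      rw [Finset.esymm_map_val]
      simp [b, hk0, hk1, β, hk2, esymm, map_sum, map_prod]
  have h4 : (Finset.univ.val.map fun j : Fin n =>
      (Polynomial.C (X (Sum.inr j)) : Polynomial (MvPolynomial (Fin n ⊕ Fin n) ℤ))).esymm k =
      Polynomial.C ((Finset.univ.val.map fun j : Fin n =>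
      (X (Sum.inr j) : MvPolynomial (Fin n ⊕ Fin n) ℤ)).esymm k) := by
    rw [Finset.esymm_map_val, Finset.esymm_map_val]
    simp [map_sum, map_prod]
  rw [h4, ← h3]
  simp [ψ]
  ring
/-- The universal polynomial `P_n` of the axiom for `λ^n(x y)`: it is the unique polynomial with
`P_n(e_1(x), …, e_n(x); e_1(y), …, e_n(y)) = e_n(x_i y_j : 1 ≤ i, j ≤ n)`
(see `aeval_prodPoly` and `prodPoly_unique`). -/
noncomputable def prodPoly (n : ℕ) : MvPolynomial (Fin n ⊕ Fin n) ℤ :=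
  Classical.choose (exists_prodPoly n)

theorem aeval_prodPoly (n : ℕ) : aeval (elemPair n) (prodPoly n) = prodTarget n :=
  Classical.choose_spec (exists_prodPoly n)

theorem prodPoly_unique (n : ℕ) (P : MvPolynomial (Fin n ⊕ Fin n) ℤ)
    (h : aeval (elemPair n) P = prodTarget n) : P = prodPoly n :=
  elemPair_algebraicIndependent n (h.trans (aeval_prodPoly n).symm)

/-- The `m`-th elementary symmetric polynomial of the `n`-fold products `x_{i_1} ⋯ x_{i_n}`,
`i_1 < ⋯ < i_n`, of `m * n` variables. -/
noncomputable def compTarget (m n : ℕ) : MvPolynomial (Fin (m * n)) ℤ :=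
  ((Finset.powersetCard n (Finset.univ : Finset (Fin (m * n)))).val.map
    (fun s => ∏ i ∈ s, X i)).esymm m

theorem compTarget_isSymmetric (m n : ℕ) : (compTarget m n).IsSymmetric := by
  classical
  intro e
  have h := coeff_prod_one_add (Finset.powersetCard n (Finset.univ : Finset (Fin (m * n))))
    (fun s => (∏ i ∈ s, X i : MvPolynomial (Fin (m * n)) ℤ)) m
  change (rename e).toRingHom (compTarget m n) = compTarget m n
  rw [compTarget, ← h, ← Polynomial.coeff_map, Polynomial.map_prod]
  congr 1
  refine Finset.prod_bij (fun s _ => s.map e.toEmbedding) ?_ ?_ ?_ ?_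
  · intro s hs
    simpa using hs
  · intro s _ t _ hst
    exact Finset.map_injective _ hst
  · intro t ht
    refine ⟨t.map e.symm.toEmbedding, by simpa using ht, ?_⟩
    ext i
    simp
  · intro s _
    have h1 : ∏ x ∈ s.map e.toEmbedding, (X x : MvPolynomial (Fin (m * n)) ℤ) =
        (rename e).toRingHom (∏ x ∈ s, X x) := by
      simp [map_prod]
    rw [h1]
    simp only [Polynomial.map_add, Polynomial.map_mul, Polynomial.map_one, Polynomial.map_C,
      Polynomial.map_X]

/-- The universal polynomial `P_{m,n}` of the axiom for `λ^m(λ^n(x))`: the expression of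
`compTarget m n` as a polynomial in the elementary symmetric polynomials `e_1, …, e_{mn}`. -/
noncomputable def compPoly (m n : ℕ) : MvPolynomial (Fin (m * n)) ℤ :=
  (esymmAlgEquiv (Fin (m * n)) ℤ (Fintype.card_fin (m * n))).symm
    ⟨compTarget m n, compTarget_isSymmetric m n⟩

theorem aeval_compPoly (m n : ℕ) :
    aeval (fun i : Fin (m * n) => esymm (Fin (m * n)) ℤ (i + 1)) (compPoly m n) =
      compTarget m n := by
  have h := (esymmAlgEquiv (Fin (m * n)) ℤ (Fintype.card_fin (m * n))).apply_symm_apply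
    ⟨compTarget m n, compTarget_isSymmetric m n⟩
  rw [← esymmAlgHom_apply, compPoly]
  exact congrArg Subtype.val h

end UniversalPolynomials

/-- A `λ`-ring (a *special* `λ`-ring in the older terminology). -/
class LambdaRing (R : Type*) [CommRing R] where
  /-- The operations `λ^n`. -/
  lam : ℕ → R → R
  lam_zero : ∀ x, lam 0 x = 1
  lam_one : ∀ x, lam 1 x = x
  lam_add : ∀ n x y, lam n (x + y) = ∑ p ∈ Finset.HasAntidiagonal.antidiagonal n, lam p.1 x * lam p.2 y
  lam_unit : ∀ n, 2 ≤ n → lam n 1 = 0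
  lam_mul : ∀ n x y, lam n (x * y) =
    aeval (Sum.elim (fun i : Fin n => lam (i + 1) x) (fun j : Fin n => lam (j + 1) y)) (prodPoly n)
  lam_lam : ∀ m n x, lam m (lam n x) =
    aeval (fun i : Fin (m * n) => lam (i + 1) x) (compPoly m n)

section SchurPolynomials

/-- The ring `Λ = ℤ[e_1, e_2, …]` of symmetric functions; the variable `X k` is `e_{k+1}`. -/
abbrev SymFun : Type := MvPolynomial ℕ ℤ

/-- The elementary symmetric function `e_n`, with `e_0 = 1`. -/
noncomputable def elemSym (n : ℕ) : SymFun := if n = 0 then 1 else X (n - 1)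

/-- The complete symmetric function `h_n`, given by `H(t) E(-t) = 1`. -/
noncomputable def completeSym (n : ℕ) : SymFun :=
  PowerSeries.coeff n (PowerSeries.invOfUnit (PowerSeries.mk fun k => (-1) ^ k * elemSym k) 1)

/-- `h_k` for an integer index `k`, with `h_k = 0` for `k < 0`. -/
noncomputable def completeSymInt (k : ℤ) : SymFun := if k < 0 then 0 else completeSym k.toNat

/-- The `N × N` matrix `(h_{r_i + j - i})`. -/
noncomputable def jt (N : ℕ) (r : ℕ → ℕ) : Matrix (Fin N) (Fin N) SymFun :=
  Matrix.of fun i j => completeSymInt ((r i : ℤ) + (j : ℤ) - (i : ℤ))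

/-- The Schur polynomial `s_μ = det (h_{μ_i + j - i})` in `Λ`. By `schur_alternant` below, it is the
symmetric function whose value in `N` variables is the quotient of alternants
`det (x_k^{μ_i + N - i}) / det (x_k^{N - i})`. -/
noncomputable def schur (μ : YoungDiagram) : SymFun := (jt (μ.colLen 0) μ.rowLen).det

/-- The map `Λ → ℤ[x_1, …, x_N]` sending `e_k` to the `k`-th elementary symmetric polynomial. -/
noncomputable def toVars (N : ℕ) : SymFun →ₐ[ℤ] MvPolynomial (Fin N) ℤ :=
  aeval fun k => esymm (Fin N) ℤ (k + 1)

theorem toVars_elemSym (N n : ℕ) : toVars N (elemSym n) = esymm (Fin N) ℤ n := by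
  rcases n with _ | n
  · simp [elemSym]
  · simp [elemSym, toVars]

theorem completeSym_zero : completeSym 0 = 1 := by
  simp [completeSym]

/-- The polynomial `∏_{i ∈ s} (1 - x_i t)`. -/
noncomputable def minusVars (N : ℕ) (s : Finset (Fin N)) :
    Polynomial (MvPolynomial (Fin N) ℤ) :=
  ∏ i ∈ s, (1 - Polynomial.C (X i) * Polynomial.X)

theorem hseries (N : ℕ) :
    (PowerSeries.mk fun n => toVars N (completeSym n)) *
      ((minusVars N Finset.univ : Polynomial (MvPolynomial (Fin N) ℤ)) :
        PowerSeries (MvPolynomial (Fin N) ℤ)) = 1 := by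
  have h1 : PowerSeries.mk (fun k => (-1) ^ k * elemSym k) * PowerSeries.mk completeSym = 1 := by
    have : PowerSeries.mk completeSym =
      PowerSeries.invOfUnit (PowerSeries.mk fun k => (-1) ^ k * elemSym k) 1 := by
      ext n : 1; simp [completeSym]
    rw [this]
    exact PowerSeries.mul_invOfUnit _ _ (by simp [elemSym])
  have h2 := congrArg (PowerSeries.map (toVars N).toRingHom) h1
  rw [map_mul, map_one, mul_comm] at h2
  convert h2 using 2
  · ext n : 1; simp
  · ext n : 1
    have h3 : minusVars N Finset.univ =
        ∏ i : Fin N, (1 + Polynomial.C (-X i : MvPolynomial (Fin N) ℤ) * Polynomial.X) := by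
      refine Finset.prod_congr rfl fun i _ => ?_
      rw [map_neg]; ring
    rw [Polynomial.coeff_coe, h3, coeff_prod_one_add]
    have h4 : (Finset.univ.val.map fun i : Fin N => -(X i : MvPolynomial (Fin N) ℤ)) =
        (Finset.univ.val.map fun i : Fin N => (X i : MvPolynomial (Fin N) ℤ)).map Neg.neg := by
      rw [Multiset.map_map]; rfl
    rw [h4, Multiset.esymm_neg, ← MvPolynomial.esymm_eq_multiset_esymm, ← toVars_elemSym]
    simp

theorem pow_eq (N : ℕ) (k : Fin N) (m : ℕ) :
    (X k : MvPolynomial (Fin N) ℤ) ^ m = ∑ j : Fin N,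
      toVars N (completeSymInt ((m : ℤ) - (N - 1 - j : ℤ))) *
        (minusVars N (Finset.univ.erase k)).coeff (N - 1 - j) := by
  set c := minusVars N (Finset.univ.erase k) with hc
  have hdeg : c.natDegree < N := by
    have h0 : c.natDegree ≤ ∑ i ∈ Finset.univ.erase k, 1 := by
      refine (Polynomial.natDegree_prod_le _ _).trans (Finset.sum_le_sum fun i _ => ?_)
      compute_degree
    have h1 : (Finset.univ.erase k).card < N := by
      have := Finset.card_erase_lt_of_mem (Finset.mem_univ k)
      simpa using this
    rw [Finset.sum_const, smul_eq_mul, mul_one] at h0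
    omega
  have h1 : (PowerSeries.mk fun n => toVars N (completeSym n)) *
      (c : PowerSeries (MvPolynomial (Fin N) ℤ)) = PowerSeries.mk fun n => X k ^ n := by
    have hg : (PowerSeries.mk fun n => (X k : MvPolynomial (Fin N) ℤ) ^ n) *
        (1 - PowerSeries.C (X k) * PowerSeries.X) = 1 := by
      ext n : 1
      rcases n with _ | n
      · simp [mul_sub, ← mul_assoc]
      · rw [mul_sub, ← mul_assoc, map_sub, PowerSeries.coeff_succ_mul_X, mul_one,
          PowerSeries.coeff_mul_C]
        simp [pow_succ, PowerSeries.coeff_one]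
    have hs := hseries N
    have hm : minusVars N Finset.univ = (1 - Polynomial.C (X k) * Polynomial.X) * c := by
      exact (Finset.mul_prod_erase Finset.univ
        (fun i => (1 - Polynomial.C (X i) * Polynomial.X :
          Polynomial (MvPolynomial (Fin N) ℤ))) (Finset.mem_univ k)).symm
    rw [hm] at hs
    push_cast at hs
    linear_combination (-(PowerSeries.mk fun n => toVars N (completeSym n)) *
      (c : PowerSeries (MvPolynomial (Fin N) ℤ))) * hg +
      (PowerSeries.mk fun n => (X k : MvPolynomial (Fin N) ℤ) ^ n) * hs
  have h2 := congrArg (PowerSeries.coeff m) h1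
  rw [PowerSeries.coeff_mk, PowerSeries.coeff_mul] at h2
  rw [← h2]
  simp only [PowerSeries.coeff_mk, Polynomial.coeff_coe]
  rw [Fin.sum_univ_eq_sum_range (fun j => toVars N (completeSymInt ((m : ℤ) - (N - 1 - j : ℤ))) *
    c.coeff (N - 1 - j)) N, ← Finset.sum_range_reflect, Finset.Nat.sum_antidiagonal_eq_sum_range_succ_mk,
    ← Finset.sum_range_reflect]
  have e1 : ∀ r ∈ Finset.range N, toVars N (completeSymInt ((m : ℤ) - (N - 1 - (N - 1 - r : ℕ) : ℤ)))
      * c.coeff (N - 1 - (N - 1 - r)) = toVars N (completeSymInt ((m : ℤ) - r)) * c.coeff r := by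
    intro r hr
    have := Finset.mem_range.1 hr
    have h5 : N - 1 - (N - 1 - r) = r := by omega
    have h6 : ((m : ℤ) - (N - 1 - (N - 1 - r : ℕ) : ℤ)) = m - r := by omega
    rw [h5, h6]
  have e2 : ∀ r ∈ Finset.range (m + 1), toVars N (completeSym (m + 1 - 1 - r)) *
      c.coeff (m - (m + 1 - 1 - r)) = toVars N (completeSymInt ((m : ℤ) - r)) * c.coeff r := by
    intro r hr
    have := Finset.mem_range.1 hr
    have h5 : m - (m + 1 - 1 - r) = r := by omega
    have h6 : ((m : ℤ) - r).toNat = m + 1 - 1 - r := by omega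
    rw [h5, completeSymInt, if_neg (by omega), h6]
  refine (Finset.sum_congr rfl e2).trans (Eq.trans ?_ (Finset.sum_congr rfl e1).symm)
  have z1 : ∀ r, m < r → toVars N (completeSymInt ((m : ℤ) - r)) * c.coeff r = 0 := by
    intro r hr
    rw [completeSymInt, if_pos (by omega), map_zero, zero_mul]
  have z2 : ∀ r, N ≤ r → toVars N (completeSymInt ((m : ℤ) - r)) * c.coeff r = 0 := by
    intro r hr
    rw [Polynomial.coeff_eq_zero_of_natDegree_lt (by omega), mul_zero]
  rcases le_total (m + 1) N with h | h
  · exact Finset.sum_subset (by intro x; simp; omega) fun r _ hr => z1 r (by simpa using hr)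
  · exact (Finset.sum_subset (by intro x; simp; omega) fun r _ hr => z2 r (by simpa using hr)).symm

theorem jt_alternant (N : ℕ) (r : ℕ → ℕ) :
    Matrix.det (Matrix.of fun i k : Fin N => (X k : MvPolynomial (Fin N) ℤ) ^ (r i + (N - 1 - i)))
     = toVars N (jt N r).det * Matrix.det (Matrix.of fun j k : Fin N =>
        (minusVars N (Finset.univ.erase k)).coeff (N - 1 - j)) := by
  rw [AlgHom.map_det, ← Matrix.det_mul]
  congr 1
  ext1 i k
  simp only [Matrix.of_apply, Matrix.mul_apply, AlgHom.mapMatrix_apply, Matrix.map_apply, jt]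
  rw [pow_eq]
  refine Finset.sum_congr rfl fun j _ => ?_
  congr 3
  have := i.2
  push_cast [Nat.sub_sub, show 1 + (i : ℕ) ≤ N by omega]
  ring

theorem jt_det_of_zero (N : ℕ) : (jt N fun _ => 0).det = 1 := by
  rw [Matrix.det_of_isUpperTriangular]
  · simp [jt, completeSymInt, completeSym_zero]
  · intro i j hij
    have : (j : ℕ) < i := hij
    simp [jt, completeSymInt]
    omega

theorem jt_det_stable (μ : YoungDiagram) (N : ℕ) (h : μ.colLen 0 ≤ N) :
    (jt N μ.rowLen).det = schur μ := by
  obtain ⟨d, rfl⟩ := Nat.exists_eq_add_of_le h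
  have hr : ∀ i, μ.colLen 0 ≤ i → μ.rowLen i = 0 := by
    intro i hi
    by_contra h0
    have h1 : (i, 0) ∈ μ := YoungDiagram.mem_iff_lt_rowLen.2 (Nat.pos_of_ne_zero h0)
    have := YoungDiagram.mem_iff_lt_colLen.1 h1
    omega
  rw [← Matrix.det_submatrix_equiv_self finSumFinEquiv, ← Matrix.fromBlocks_toBlocks
    ((jt (μ.colLen 0 + d) μ.rowLen).submatrix finSumFinEquiv finSumFinEquiv)]
  have h21 : ((jt (μ.colLen 0 + d) μ.rowLen).submatrix finSumFinEquiv
      finSumFinEquiv).toBlocks₂₁ = 0 := by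
    ext1 i j
    simp [Matrix.toBlocks₂₁, jt, completeSymInt, hr]
    omega
  have h22 : ((jt (μ.colLen 0 + d) μ.rowLen).submatrix finSumFinEquiv
      finSumFinEquiv).toBlocks₂₂ = jt d fun _ => 0 := by
    ext1 i j
    simp [Matrix.toBlocks₂₂, jt, hr]
  rw [h21, h22, Matrix.det_fromBlocks_zero₂₁, jt_det_of_zero, mul_one]
  rfl

/-- The bialternant formula `s_μ(x_1, …, x_N) = det (x_k^{μ_i + N - i}) / det (x_k^{N - i})`,
for every number `N` of variables not smaller than the number of rows of `μ`. -/
theorem schur_alternant (μ : YoungDiagram) (N : ℕ) (h : μ.colLen 0 ≤ N) :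
    toVars N (schur μ) *
      Matrix.det (Matrix.of fun i k : Fin N => (X k : MvPolynomial (Fin N) ℤ) ^ (N - 1 - i : ℕ)) =
    Matrix.det (Matrix.of fun i k : Fin N =>
      (X k : MvPolynomial (Fin N) ℤ) ^ (μ.rowLen i + (N - 1 - i))) := by
  have h0 := jt_alternant N fun _ => 0
  rw [jt_det_of_zero, map_one, one_mul] at h0
  simp only [zero_add] at h0
  rw [jt_alternant, jt_det_stable μ N h, h0]
end SchurPolynomials

section Elements

variable {R : Type*} [CommRing R] [LambdaRing R]

/-- The operation `f(x) = u_x(f)` of a symmetric function `f`, where `u_x : Λ → R` sends `e_n` to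
`λ^n(x)`. -/
noncomputable def symOp (f : SymFun) (x : R) : R :=
  aeval (fun k => LambdaRing.lam (k + 1) x) f

/-- `x` is Schur-finite if there is a partition `ν` such that `s_μ(x) = 0` for every partition `μ`
containing `ν`. -/
def IsSchurFinite (x : R) : Prop :=
  ∃ ν : YoungDiagram, ∀ μ : YoungDiagram, ν ≤ μ → symOp (schur μ) x = 0

/-- `x` is a line element if `λ^n(x) = 0` for all `n > 1`. -/
def IsLineElement (x : R) : Prop := ∀ n, 1 < n → LambdaRing.lam n x = 0

end Elements

/-- The underlying set of the big Witt ring `W(A)`: the power series over `A` with constant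
coefficient `1`. -/
def BigWitt (A : Type*) [CommRing A] : Type _ :=
  {f : PowerSeries A // PowerSeries.constantCoeff f = 1}

namespace BigWitt

variable {A : Type*} [CommRing A]

/-- The element `1 + ∑_{n ≥ 1} a_n t^n` of `W(A)`. -/
noncomputable def ofCoeffs (a : ℕ → A) : BigWitt A :=
  ⟨PowerSeries.mk fun n => if n = 0 then 1 else a n, by simp⟩

/-- The coefficient `a_n` of an element `1 + ∑_{n ≥ 1} a_n t^n` of `W(A)`. -/
noncomputable def coeff (n : ℕ) (f : BigWitt A) : A := PowerSeries.coeff n f.1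

/-- The zero of `W(A)` is the series `1`. -/
noncomputable def zero : BigWitt A := ⟨1, by simp⟩

/-- The unit of `W(A)` is the series `1 + t`. -/
noncomputable def one : BigWitt A := ⟨1 + PowerSeries.X, by simp⟩

/-- Addition in `W(A)` is multiplication of power series. -/
noncomputable def add (f g : BigWitt A) : BigWitt A := ⟨f.1 * g.1, by simp [f.2, g.2]⟩

/-- Multiplication in `W(A)`: the `n`-th coefficient is `P_n(a_1, …, a_n; b_1, …, b_n)`. It is
determined by `(1 + a t) * (1 + b t) = 1 + a b t`, functoriality, biadditivity and continuity. -/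
noncomputable def mul (f g : BigWitt A) : BigWitt A :=
  ofCoeffs fun n => aeval (Sum.elim (fun i : Fin n => f.coeff (i + 1))
    (fun j : Fin n => g.coeff (j + 1))) (prodPoly n)

/-- The operation `λ^m` on `W(A)`: the `n`-th coefficient is `P_{n,m}(a_1, …, a_{nm})`. -/
noncomputable def lam (m : ℕ) (f : BigWitt A) : BigWitt A :=
  ofCoeffs fun n => aeval (fun i : Fin (n * m) => f.coeff (i + 1)) (compPoly n m)

/-- The given ring structure and `λ`-structure on the set `W(A)` are those of the big Witt
ring. -/
structure IsStandard (A : Type*) [CommRing A] [CommRing (BigWitt A)]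
    [LambdaRing (BigWitt A)] : Prop where
  zero_eq : (0 : BigWitt A) = zero
  one_eq : (1 : BigWitt A) = one
  add_eq : ∀ f g : BigWitt A, f + g = add f g
  mul_eq : ∀ f g : BigWitt A, f * g = mul f g
  lam_eq : ∀ (m : ℕ) (f : BigWitt A), LambdaRing.lam m f = lam m f

end BigWitt

end LambdaTheory

/-! Finite products of factors 1 + a t are dense in W(E): since E is algebraically closed, any
prescribed coefficients up to degree N, with constant term 1, are the elementary symmetric functions
of N elements (`exists_multiset_esymm_eq`). On such products the structure of W(E) is combinatorial:
addition is union of multisets, multiplication takes all pairwise products, and λ^n takes all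
products of n members (`split_add`, `split_pairProds`, `split_subsetProds`). This uses that P_n and
P_{m,n} keep their defining property for families of any size (`aeval_esymm_prodPoly`,
`aeval_esymm_compPoly`). Every coefficient of a result depends on finitely many coefficients of the
inputs, so the axioms need only be checked on these products. Moreover a ↦ 1 + a t is
multiplicative, so λ^n of a product is e_n of line elements (`lam_split`), and the axioms for
λ^n(xy) and λ^m(λ^n x) become the same symmetric function identities, now read in the ring W(E)
itself.

That ι is a λ-homomorphism is a coefficientwise reading of the axioms of R, and it is injective
because the coefficient of t is x.

Let x be Schur-finite. By the Jacobi–Trudi definition of s_μ, the determinants det (h_{k_i+j}(x))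
vanish for all decreasing sequences of sufficiently large k_i. Hence the windows of N consecutive
h's do not span E^N, the h's satisfy a linear recurrence (`exists_linear_recurrence`), and their
generating series is rational. So is its inverse, which is the λ-series of x up to the sign of t.
Numerator and denominator can be given constant term 1 and split over E into factors 1 + a t; these
are line elements, and a quotient of series is a difference in W(E). -/

namespace LambdaTheory
open MvPolynomial

/-! ### Elementary symmetric functions of multisets and the universal polynomials -/

section SymmetricFunctionsOfMultisets

variable {A B : Type*} [CommRing A] [CommRing B]

/-- The multiset of the products of `n` members of `s`. -/
def subsetProds (n : ℕ) (s : Multiset A) : Multiset A := (s.powersetCard n).map Multiset.prod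

/-- The multiset of the products of a member of `s` and a member of `t`. -/
def pairProds (s t : Multiset A) : Multiset A := (s ×ˢ t).map fun p => p.1 * p.2

theorem esymm_zero' (s : Multiset A) : s.esymm 0 = 1 := by simp [Multiset.esymm]

theorem esymm_empty_succ (n : ℕ) : (0 : Multiset A).esymm (n + 1) = 0 := by
  simp [Multiset.esymm, Multiset.powersetCard_zero_right]

theorem esymm_cons_succ (a : A) (s : Multiset A) (n : ℕ) :
    (a ::ₘ s).esymm (n + 1) = s.esymm (n + 1) + a * s.esymm n := by
  simp [Multiset.esymm, Multiset.powersetCard_cons, Multiset.sum_map_mul_left]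

theorem coeff_prod_map_one_add (s : Multiset A) (n : ℕ) :
    (s.map fun a => (1 + Polynomial.C a * Polynomial.X : Polynomial A)).prod.coeff n =
      s.esymm n := by
  induction s using Multiset.induction_on generalizing n with
  | empty => rcases n with _ | n <;> simp [esymm_zero', esymm_empty_succ, Polynomial.coeff_one]
  | cons a s ih =>
    rw [Multiset.map_cons, Multiset.prod_cons, add_mul, one_mul, Polynomial.coeff_add, ih,
      mul_assoc, Polynomial.coeff_C_mul]
    rcases n with _ | n
    · simp [esymm_zero']
    · rw [Polynomial.coeff_X_mul, ih, esymm_cons_succ]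

theorem esymm_add (s t : Multiset A) (n : ℕ) :
    (s + t).esymm n = ∑ p ∈ Finset.HasAntidiagonal.antidiagonal n, s.esymm p.1 * t.esymm p.2 := by
  simp only [← coeff_prod_map_one_add, Multiset.map_add, Multiset.prod_add, Polynomial.coeff_mul]

theorem esymm_map_ringHom (φ : A →+* B) (s : Multiset A) (n : ℕ) :
    (s.map φ).esymm n = φ (s.esymm n) := by
  simp only [Multiset.esymm, Multiset.powersetCard_map, map_multiset_sum, Multiset.map_map,
    Function.comp_def, map_multiset_prod]

/-- Multiplicativity alone suffices, and this generality matters: the lemma is applied to `lineHom`,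
a monoid homomorphism whose values are added in W(E). -/
theorem subsetProds_map (φ : A →* B) (s : Multiset A) (n : ℕ) :
    subsetProds n (s.map φ) = (subsetProds n s).map φ := by
  simp only [subsetProds, Multiset.powersetCard_map, Multiset.map_map, Function.comp_def,
    map_multiset_prod]

theorem pairProds_map (φ : A →* B) (s t : Multiset A) :
    pairProds (s.map φ) (t.map φ) = (pairProds s t).map φ := by
  induction s using Multiset.induction_on with
  | empty => simp [pairProds]
  | cons a s ih =>
    simp only [pairProds, Multiset.map_cons, Multiset.cons_product, Multiset.map_add,
      Multiset.map_map, Function.comp_def, map_mul] at ih ⊢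
    rw [ih]

theorem pairProds_zero (t : Multiset A) : pairProds 0 t = 0 := by simp [pairProds]

theorem pairProds_cons (a : A) (s t : Multiset A) :
    pairProds (a ::ₘ s) t = t.map (a * ·) + pairProds s t := by
  simp [pairProds, Multiset.cons_product]

theorem pairProds_comm (s t : Multiset A) : pairProds s t = pairProds t s := by
  rw [pairProds, pairProds, ← Multiset.map_swap_product, Multiset.map_map]
  simp [mul_comm]

theorem pairProds_add_left (s s' t : Multiset A) :
    pairProds (s + s') t = pairProds s t + pairProds s' t := by
  simp [pairProds, Multiset.add_product]

theorem pairProds_map_mul_left (a : A) (s t : Multiset A) :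
    pairProds (s.map (a * ·)) t = (pairProds s t).map (a * ·) := by
  induction s using Multiset.induction_on with
  | empty => simp [pairProds_zero]
  | cons b s ih => simp [pairProds_cons, ih, mul_assoc]

theorem pairProds_assoc (s t u : Multiset A) :
    pairProds (pairProds s t) u = pairProds s (pairProds t u) := by
  induction s using Multiset.induction_on with
  | empty => simp [pairProds_zero]
  | cons a s ih => rw [pairProds_cons, pairProds_cons, pairProds_add_left, ih,
      pairProds_map_mul_left]

theorem esymm_map_mul_left (a : A) (s : Multiset A) (n : ℕ) :
    (s.map (a * ·)).esymm n = a ^ n * s.esymm n := by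
  have := Multiset.pow_smul_esymm a n s
  simpa using this.symm

theorem subsetProds_map_mul_left (a : A) (s : Multiset A) (n : ℕ) :
    subsetProds n (s.map (a * ·)) = (subsetProds n s).map (a ^ n * ·) := by
  simp only [subsetProds, Multiset.powersetCard_map, Multiset.map_map, Function.comp_def]
  refine Multiset.map_congr rfl fun u hu => ?_
  rw [Multiset.prod_map_mul, Multiset.map_const', Multiset.prod_replicate,
    (Multiset.mem_powersetCard.1 hu).2, Multiset.map_id']

theorem exists_eq_univ_map {α : Type*} (s : Multiset α) :
    ∃ x : Fin s.card → α, s = Finset.univ.val.map x := by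
  induction s using Quotient.inductionOn with
  | h l => exact ⟨l.get, ((Fin.univ_val_map l.get).trans (congrArg _ (List.ofFn_get l))).symm⟩

theorem exists_eq_univ_map_of_card {α : Type*} {s : Multiset α} {n : ℕ} (h : s.card = n) :
    ∃ x : Fin n → α, s = Finset.univ.val.map x := by
  subst h; exact exists_eq_univ_map s

theorem esymm_cons_zero (s : Multiset A) (n : ℕ) : (0 ::ₘ s).esymm n = s.esymm n := by
  rcases n with _ | n
  · simp [esymm_zero']
  · simp [esymm_cons_succ]

theorem esymm_add_replicate_zero (s : Multiset A) (d n : ℕ) :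
    (s + Multiset.replicate d 0).esymm n = s.esymm n := by
  induction d with
  | zero => simp
  | succ d ih => rw [Multiset.replicate_succ, Multiset.add_cons, esymm_cons_zero, ih]

/-- A subset using the new element has product zero, and zeros do not affect elementary symmetric
functions. This permits padding to a common cardinality. -/
theorem esymm_subsetProds_cons_zero (n m : ℕ) (s : Multiset A) :
    (subsetProds n (0 ::ₘ s)).esymm m = (subsetProds n s).esymm m := by
  rcases n with _ | n
  · simp [subsetProds]
  · simp only [subsetProds, Multiset.powersetCard_cons, Multiset.map_add, Multiset.map_map,
      Function.comp_def, Multiset.prod_cons, zero_mul, Multiset.map_const']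
    rw [esymm_add_replicate_zero]

theorem esymm_subsetProds_add_replicate_zero (n m d : ℕ) (s : Multiset A) :
    (subsetProds n (s + Multiset.replicate d 0)).esymm m = (subsetProds n s).esymm m := by
  induction d with
  | zero => simp
  | succ d ih => rw [Multiset.replicate_succ, Multiset.add_cons, esymm_subsetProds_cons_zero, ih]

theorem ringHom_aeval_int [Algebra ℤ A] [Algebra ℤ B] {σ : Type*} (φ : A →+* B) (u : σ → A) (p : MvPolynomial σ ℤ) :
    φ (aeval u p) = aeval (fun i => φ (u i)) p :=
  (comp_aeval_apply u { φ with commutes' := by simp : A →ₐ[ℤ] B } p)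

/-- Serves to pass truncated equality, of polynomials and of elements of W(E), through integer
polynomial expressions. -/
theorem aeval_rel [Algebra ℤ A] {σ : Type*} (r : A → A → Prop) (hrefl : ∀ a, r a a)
    (hadd : ∀ a b c d, r a b → r c d → r (a + c) (b + d))
    (hmul : ∀ a b c d, r a b → r c d → r (a * c) (b * d)) {u v : σ → A} (h : ∀ i, r (u i) (v i))
    (p : MvPolynomial σ ℤ) : r (aeval u p) (aeval v p) := by
  induction p using MvPolynomial.induction_on with
  | C a => simpa using hrefl _
  | add p q hp hq => simpa using hadd _ _ _ _ hp hq
  | mul_X p i hp => simpa using hmul _ _ _ _ hp (h i)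

/-- The products split into the scaled copies a·t, and e_k(a·t) = a^k e_k(t); hence no e_j(t) with j
> k enters degree k. -/
theorem esymm_pairProds_congr {N : ℕ} (s : Multiset A) {t t' : Multiset A}
    (h : ∀ k ≤ N, t.esymm k = t'.esymm k) :
    ∀ k ≤ N, (pairProds s t).esymm k = (pairProds s t').esymm k := by
  induction s using Multiset.induction_on with
  | empty => simp [pairProds_zero]
  | cons a s ih =>
    intro k hk
    rw [pairProds_cons, pairProds_cons, esymm_add, esymm_add]
    refine Finset.sum_congr rfl fun p hp => ?_
    have := Finset.HasAntidiagonal.mem_antidiagonal.1 hp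
    rw [esymm_map_mul_left, esymm_map_mul_left, h _ (by omega), ih _ (by omega)]

/-- The symmetric function `e_m` of the products of `n` of `r` elements is a polynomial in
the elementary symmetric functions of the `r` elements. -/
theorem exists_aeval_esymm_eq_esymm_subsetProds (m n r : ℕ) :
    ∃ Q : MvPolynomial (Fin r) ℤ, ∀ (A : Type*) [CommRing A] (s : Multiset A), s.card = r →
      aeval (fun i : Fin r => s.esymm (i + 1)) Q = (subsetProds n s).esymm m := by
  let X' : Multiset (MvPolynomial (Fin r) ℤ) := Finset.univ.val.map X
  have hsymm : ((subsetProds n X').esymm m).IsSymmetric := by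
    intro e
    change (rename e).toRingHom _ = _
    rw [← esymm_map_ringHom]
    have h1 := subsetProds_map ((rename e).toRingHom : MvPolynomial (Fin r) ℤ →+*
      MvPolynomial (Fin r) ℤ).toMonoidHom X' n
    have h2 : X'.map (rename e) = X' := by
      simp only [X', Multiset.map_map, Function.comp_def, rename_X]
      rw [← Function.comp_def X e, ← Multiset.map_map]
      congr 1
      exact congrArg Finset.val (Finset.map_univ_equiv e)
    rw [show X'.map ((rename e).toRingHom : MvPolynomial (Fin r) ℤ →+*
      MvPolynomial (Fin r) ℤ).toMonoidHom = X' from h2] at h1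
    exact congrArg (fun u => Multiset.esymm u m) h1.symm
  obtain ⟨Q, hQ⟩ := esymmAlgHom_surjective (σ := Fin r) ℤ (n := r) (by simp) ⟨_, hsymm⟩
  have hQ' : aeval (fun i : Fin r => esymm (Fin r) ℤ (i + 1)) Q = (subsetProds n X').esymm m := by
    rw [← esymmAlgHom_apply, hQ]
  refine ⟨Q, fun A _ s hs => ?_⟩
  obtain ⟨x, rfl⟩ := exists_eq_univ_map_of_card hs
  have h1 := congrArg (aeval x).toRingHom hQ'
  have hX : X'.map (aeval x).toRingHom = Finset.univ.val.map x := by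
    simp [X', Function.comp_def]
  rw [ringHom_aeval_int, ← esymm_map_ringHom] at h1
  have h3 := subsetProds_map (aeval x : MvPolynomial (Fin r) ℤ →ₐ[ℤ] A).toRingHom.toMonoidHom X' n
  rw [show X'.map (aeval x : MvPolynomial (Fin r) ℤ →ₐ[ℤ] A).toRingHom.toMonoidHom = _ from hX]
    at h3
  rw [h3]
  refine Eq.trans ?_ h1
  congr 2
  funext i
  exact (aeval_esymm_eq_multiset_esymm (Fin r) ℤ _ x).symm

/-- `e_m` of the products of `n` elements of `s` depends on `e_k(s)` for `k ≤ m * n` only. -/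
theorem esymm_subsetProds_congr {m n : ℕ} {s s' : Multiset A} (hc : s.card = s'.card)
    (h : ∀ k ≤ m * n, s.esymm k = s'.esymm k) :
    (subsetProds n s).esymm m = (subsetProds n s').esymm m := by
  obtain ⟨Q, hQ⟩ := exists_aeval_esymm_eq_esymm_subsetProds m n s.card
  -- Scaling every element by an indeterminate X records weights: e_k acquires X^k and the target
  -- acquires X^{mn}. Comparing coefficients up to X^{mn} then shows that only e_k with k ≤ mn
  -- matter, without studying the monomials of Q.
  let sc : Multiset A → Multiset (Polynomial A) := fun s =>
    (s.map Polynomial.C).map (Polynomial.X * ·)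
  have key : ∀ s : Multiset A, ((subsetProds n (sc s)).esymm m).coeff (m * n) =
      (subsetProds n s).esymm m := by
    intro s
    have h1 := subsetProds_map (Polynomial.C : A →+* Polynomial A).toMonoidHom s n
    simp only [sc]
    rw [subsetProds_map_mul_left, esymm_map_mul_left, show s.map Polynomial.C =
      s.map (Polynomial.C : A →+* Polynomial A).toMonoidHom from rfl, h1,
      show ((subsetProds n s).map (Polynomial.C : A →+* Polynomial A).toMonoidHom) =
        (subsetProds n s).map Polynomial.C from rfl, esymm_map_ringHom, ← pow_mul, mul_comm n m,
      Polynomial.coeff_X_pow_mul', if_pos le_rfl]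
    simp
  have key2 : ∀ (s : Multiset A) k, (sc s).esymm k = Polynomial.X ^ k * Polynomial.C (s.esymm k) := by
    intro s k
    rw [esymm_map_mul_left, esymm_map_ringHom]
  rw [← key, ← key, ← hQ _ (sc s) (by simp [sc]), ← hQ _ (sc s') (by simp [sc, hc])]
  refine aeval_rel (fun p q : Polynomial A => ∀ k ≤ m * n, p.coeff k = q.coeff k)
    (fun _ _ _ => rfl) ?_ ?_ ?_ Q _ le_rfl
  · intro a b c d h1 h2 k hk
    rw [Polynomial.coeff_add, Polynomial.coeff_add, h1 k hk, h2 k hk]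
  · intro a b c d h1 h2 k hk
    rw [Polynomial.coeff_mul, Polynomial.coeff_mul]
    refine Finset.sum_congr rfl fun p hp => ?_
    have := Finset.HasAntidiagonal.mem_antidiagonal.1 hp
    rw [h1 _ (by omega), h2 _ (by omega)]
  · intro i k hk
    rw [key2, key2, Polynomial.coeff_X_pow_mul', Polynomial.coeff_X_pow_mul']
    split_ifs with hi
    · rw [h _ (by omega)]
    · rfl

/-- Vieta's formulas for the monic polynomial ∑ c_k X^{N-k}; negating its roots removes the signs.
-/
theorem exists_multiset_esymm_eq {E : Type*} [Field E] [IsAlgClosed E] (c : ℕ → E) (hc : c 0 = 1)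
    (N : ℕ) : ∃ s : Multiset E, s.card = N ∧ ∀ k ≤ N, s.esymm k = c k := by
  let p : Polynomial E := ∑ k ∈ Finset.range (N + 1), Polynomial.C (c k) * Polynomial.X ^ (N - k)
  have hp : ∀ k ≤ N, p.coeff (N - k) = c k := by
    intro k hk
    simp only [p, Polynomial.finsetSum_coeff, Polynomial.coeff_C_mul_X_pow]
    rw [Finset.sum_eq_single k]
    · simp
    · intro b hb hbk
      have := Finset.mem_range.1 hb
      rw [if_neg (by omega)]
    · intro h; simp at h; omega
  have hdeg : p.natDegree ≤ N := by
    refine Polynomial.natDegree_sum_le_of_forall_le _ _ fun k _ => ?_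
    exact (Polynomial.natDegree_C_mul_X_pow_le _ _).trans (Nat.sub_le _ _)
  have h0 : p.coeff N = 1 := by simpa [hc] using hp 0 (Nat.zero_le _)
  have hmon : p.Monic := Polynomial.monic_of_natDegree_le_of_coeff_eq_one N hdeg h0
  have hdeg' : p.natDegree = N := by
    refine le_antisymm hdeg (Polynomial.le_natDegree_of_ne_zero (by simp [h0]))
  have hs := IsAlgClosed.splits p
  refine ⟨p.roots.map Neg.neg, ?_, fun k hk => ?_⟩
  · rw [Multiset.card_map, ← hs.natDegree_eq_card_roots, hdeg']
  · have := Polynomial.coeff_eq_esymm_roots_of_splits hs (k := N - k) (by omega)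
    rw [hp k hk, hmon.leadingCoeff, hdeg', Nat.sub_sub_self hk] at this
    rw [Multiset.esymm_neg, this, one_mul]

theorem aeval_esymm_prodPoly_of_card {s t : Multiset A} {n : ℕ} (hs : s.card = n)
    (ht : t.card = n) :
    aeval (Sum.elim (fun i : Fin n => s.esymm (i + 1)) (fun j : Fin n => t.esymm (j + 1)))
      (prodPoly n) = (pairProds s t).esymm n := by
  obtain ⟨x, rfl⟩ := exists_eq_univ_map_of_card hs
  obtain ⟨y, rfl⟩ := exists_eq_univ_map_of_card ht
  have h := congrArg (aeval (Sum.elim x y)).toRingHom (aeval_prodPoly n)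
  rw [ringHom_aeval_int, prodTarget, ← esymm_map_ringHom] at h
  convert h using 2
  · congr 1
    funext i
    rcases i with i | i
    · simp [elemPair, aeval_rename, aeval_esymm_eq_multiset_esymm]
    · simp [elemPair, aeval_rename, aeval_esymm_eq_multiset_esymm]
  · rw [pairProds, Multiset.map_map, ← Finset.univ_product_univ, Finset.product_val]
    simp only [Function.comp_def]
    rw [show (Finset.univ.val.map x ×ˢ Finset.univ.val.map y) =
      ((Finset.univ : Finset (Fin n)).val ×ˢ (Finset.univ : Finset (Fin n)).val).map
        (Prod.map x y) from ?_, Multiset.map_map]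
    · simp
    · simp [SProd.sprod, Multiset.product, Multiset.map_bind, Multiset.bind_map,
        Function.comp_def]

theorem aeval_esymm_compPoly_of_card {s : Multiset A} {m n : ℕ} (hs : s.card = m * n) :
    aeval (fun i : Fin (m * n) => s.esymm (i + 1)) (compPoly m n) =
      (subsetProds n s).esymm m := by
  obtain ⟨x, rfl⟩ := exists_eq_univ_map_of_card hs
  have h := congrArg (aeval x).toRingHom (aeval_compPoly m n)
  rw [ringHom_aeval_int, compTarget, ← esymm_map_ringHom] at h
  convert h using 2
  · congr 1
    funext i
    exact (aeval_esymm_eq_multiset_esymm (Fin (m * n)) ℤ _ x).symm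
  · rw [subsetProds, Multiset.powersetCard_map, ← Finset.map_val_val_powersetCard]
    simp only [Multiset.map_map, Function.comp_def, AlgHom.toRingHom_eq_coe, RingHom.coe_coe,
      map_prod, aeval_X]
    rfl

/-- The polynomial ring ℤ[A] surjects onto A and embeds in an algebraic closure of its fraction
field, so identities with integer coefficients proved over algebraically closed fields descend to
every commutative ring. -/
theorem exists_isAlgClosed_lift.{u} (A : Type u) [CommRing A] :
    ∃ (B E : Type u) (_ : CommRing B) (_ : Field E) (_ : IsAlgClosed E) (f : B →+* A)
      (g : B →+* E), Function.Surjective f ∧ Function.Injective g := by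
  refine ⟨MvPolynomial A (ℤ), AlgebraicClosure (FractionRing (MvPolynomial A (ℤ))),
    inferInstance, inferInstance, inferInstance,
    eval₂Hom (Int.castRingHom A) id,
    (algebraMap (FractionRing (MvPolynomial A ℤ)) _).comp (algebraMap (MvPolynomial A ℤ) _),
    fun a => ⟨X a, by simp⟩, ?_⟩
  exact (algebraMap (FractionRing (MvPolynomial A ℤ)) _).injective.comp
    (IsFractionRing.injective (MvPolynomial A ℤ) _)

theorem aeval_esymm_prodPoly_map (φ : A →+* B) (s t : Multiset A) (n : ℕ) :
    aeval (Sum.elim (fun i : Fin n => (s.map φ).esymm (i + 1))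
      (fun j : Fin n => (t.map φ).esymm (j + 1))) (prodPoly n) =
    φ (aeval (Sum.elim (fun i : Fin n => s.esymm (i + 1)) (fun j : Fin n => t.esymm (j + 1)))
      (prodPoly n)) := by
  rw [ringHom_aeval_int]
  congr 2
  funext i
  rcases i with i | i <;> simp [esymm_map_ringHom]

theorem esymm_pairProds_map (φ : A →+* B) (s t : Multiset A) (n : ℕ) :
    (pairProds (s.map φ) (t.map φ)).esymm n = φ ((pairProds s t).esymm n) := by
  rw [← esymm_map_ringHom]
  exact congrArg (fun u => Multiset.esymm u n) (pairProds_map φ.toMonoidHom s t)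

theorem aeval_esymm_compPoly_map (φ : A →+* B) (s : Multiset A) (m n : ℕ) :
    aeval (fun i : Fin (m * n) => (s.map φ).esymm (i + 1)) (compPoly m n) =
      φ (aeval (fun i : Fin (m * n) => s.esymm (i + 1)) (compPoly m n)) := by
  rw [ringHom_aeval_int]
  congr 2
  funext i
  simp [esymm_map_ringHom]

theorem esymm_subsetProds_map (φ : A →+* B) (s : Multiset A) (m n : ℕ) :
    (subsetProds n (s.map φ)).esymm m = φ ((subsetProds n s).esymm m) := by
  rw [← esymm_map_ringHom]
  exact congrArg (fun u => Multiset.esymm u m) (subsetProds_map φ.toMonoidHom s n)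

/-- `P_n(e(s); e(t))` is `e_n` of the products `a * b`, for families of any size. -/
theorem aeval_esymm_prodPoly (s t : Multiset A) (n : ℕ) :
    aeval (Sum.elim (fun i : Fin n => s.esymm (i + 1)) (fun j : Fin n => t.esymm (j + 1)))
      (prodPoly n) = (pairProds s t).esymm n := by
  obtain ⟨B, E, _, _, _, f, g, hf, hg⟩ := exists_isAlgClosed_lift A
  obtain ⟨s, rfl⟩ := Multiset.map_surjective_of_surjective hf s
  obtain ⟨t, rfl⟩ := Multiset.map_surjective_of_surjective hf t
  rw [aeval_esymm_prodPoly_map, esymm_pairProds_map]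
  congr 1
  apply hg
  rw [← aeval_esymm_prodPoly_map, ← esymm_pairProds_map]
  -- Both sides depend only on e_k for k ≤ n, so each family may be replaced by one of exactly n
  -- elements, where the defining property of P_n applies.
  obtain ⟨s', hs', h1⟩ := exists_multiset_esymm_eq (s.map g).esymm (esymm_zero' _) n
  obtain ⟨t', ht', h2⟩ := exists_multiset_esymm_eq (t.map g).esymm (esymm_zero' _) n
  rw [← esymm_pairProds_congr _ h2 n le_rfl, pairProds_comm, ← esymm_pairProds_congr _ h1 n le_rfl,
    pairProds_comm, ← aeval_esymm_prodPoly_of_card hs' ht']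
  congr 2
  funext i
  rcases i with i | i
  · simp [h1 (i + 1) i.2]
  · simp [h2 (i + 1) i.2]

/-- `P_{m,n}(e(s))` is `e_m` of the products of `n` members of `s`, for `s` of any size. -/
theorem aeval_esymm_compPoly (s : Multiset A) (m n : ℕ) :
    aeval (fun i : Fin (m * n) => s.esymm (i + 1)) (compPoly m n) =
      (subsetProds n s).esymm m := by
  obtain ⟨B, E, _, _, _, f, g, hf, hg⟩ := exists_isAlgClosed_lift A
  obtain ⟨s, rfl⟩ := Multiset.map_surjective_of_surjective hf s
  rw [aeval_esymm_compPoly_map, esymm_subsetProds_map]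
  congr 1
  apply hg
  rw [← aeval_esymm_compPoly_map, ← esymm_subsetProds_map]
  obtain ⟨s', hs', h1⟩ := exists_multiset_esymm_eq (s.map g).esymm (esymm_zero' _) (m * n)
  -- The comparison requires equal cardinalities: each multiset is padded with as many zeros as the
  -- other has elements.
  rw [← esymm_subsetProds_add_replicate_zero n m (m * n), esymm_subsetProds_congr
    (s' := s' + Multiset.replicate (s.map g).card 0) (by simp [hs', add_comm]) ?_,
    esymm_subsetProds_add_replicate_zero, ← aeval_esymm_compPoly_of_card hs']
  · congr 2
    funext i
    rw [h1 (i + 1) i.2]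
  · intro k hk
    rw [esymm_add_replicate_zero, esymm_add_replicate_zero, h1 k hk]

end SymmetricFunctionsOfMultisets

namespace BigWitt

/-! ### Products of linear factors and truncated equality in W(A) -/

section Split

variable {A : Type*} [CommRing A]

theorem ext_coeff {f g : BigWitt A} (h : ∀ n, f.coeff n = g.coeff n) : f = g :=
  Subtype.ext (PowerSeries.ext h)

theorem coeff_zero' (f : BigWitt A) : f.coeff 0 = 1 := by
  simpa [coeff] using f.2

theorem coeff_ofCoeffs (a : ℕ → A) (n : ℕ) : (ofCoeffs a).coeff n = if n = 0 then 1 else a n := by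
  simp [coeff, ofCoeffs]

theorem coeff_add (f g : BigWitt A) (n : ℕ) : (add f g).coeff n =
    ∑ p ∈ Finset.HasAntidiagonal.antidiagonal n, f.coeff p.1 * g.coeff p.2 :=
  PowerSeries.coeff_mul n f.1 g.1

/-- The additive inverse in `W(A)`: the inverse power series. -/
noncomputable def neg (f : BigWitt A) : BigWitt A := ⟨PowerSeries.invOfUnit f.1 1, by simp⟩

/-- The element `∏ (1 + a t)`, `a ∈ s`, of `W(A)`. -/
noncomputable def split (s : Multiset A) : BigWitt A := ofCoeffs s.esymm

theorem coeff_split (s : Multiset A) (n : ℕ) : (split s).coeff n = s.esymm n := by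
  rw [split, coeff_ofCoeffs]
  split_ifs with h
  · rw [h, esymm_zero']
  · rfl

theorem split_zero : split (0 : Multiset A) = zero := by
  refine ext_coeff fun n => ?_
  rw [coeff_split]
  rcases n with _ | n
  · rw [esymm_zero', coeff_zero']
  · rw [esymm_empty_succ]; simp [coeff, zero, PowerSeries.coeff_one]

theorem split_one : split ({1} : Multiset A) = one := by
  refine ext_coeff fun n => ?_
  rw [coeff_split]
  rcases n with _ | _ | n
  · rw [esymm_zero', coeff_zero']
  · rw [← Multiset.cons_zero, esymm_cons_succ, esymm_zero', esymm_empty_succ]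
    simp [coeff, one, PowerSeries.coeff_one]
  · rw [← Multiset.cons_zero, esymm_cons_succ, esymm_empty_succ, esymm_empty_succ]
    simp [coeff, one, PowerSeries.coeff_one, PowerSeries.coeff_X]

theorem split_add (s t : Multiset A) : split (s + t) = add (split s) (split t) := by
  refine ext_coeff fun n => ?_
  simp only [coeff_add, coeff_split, esymm_add]

theorem split_pairProds (s t : Multiset A) : split (pairProds s t) = mul (split s) (split t) := by
  refine ext_coeff fun n => ?_
  rw [mul, coeff_ofCoeffs, coeff_split]
  split_ifs with h
  · rw [h, esymm_zero']
  · simp only [coeff_split, aeval_esymm_prodPoly]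

theorem split_subsetProds (m : ℕ) (s : Multiset A) :
    split (subsetProds m s) = lam m (split s) := by
  refine ext_coeff fun n => ?_
  rw [lam, coeff_ofCoeffs, coeff_split]
  split_ifs with h
  · rw [h, esymm_zero']
  · simp only [coeff_split, aeval_esymm_compPoly]

/-- Two elements of `W(A)` are equal up to `t^N`. -/
def EqUpTo (N : ℕ) (f g : BigWitt A) : Prop := ∀ k ≤ N, f.coeff k = g.coeff k

theorem EqUpTo.refl {N : ℕ} (f : BigWitt A) : EqUpTo N f f := fun _ _ => rfl

theorem EqUpTo.symm {N : ℕ} {f g : BigWitt A} (h : EqUpTo N f g) : EqUpTo N g f :=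
  fun k hk => (h k hk).symm

theorem EqUpTo.trans {N : ℕ} {f g h : BigWitt A} (h₁ : EqUpTo N f g) (h₂ : EqUpTo N g h) :
    EqUpTo N f h := fun k hk => (h₁ k hk).trans (h₂ k hk)

theorem EqUpTo.mono {M N : ℕ} (hMN : M ≤ N) {f g : BigWitt A} (h : EqUpTo N f g) :
    EqUpTo M f g := fun k hk => h k (hk.trans hMN)

theorem eq_of_forall_eqUpTo {f g : BigWitt A} (h : ∀ N, EqUpTo N f g) : f = g :=
  ext_coeff fun n => h n n le_rfl

theorem EqUpTo.add {N : ℕ} {f f' g g' : BigWitt A} (hf : EqUpTo N f f') (hg : EqUpTo N g g') :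
    EqUpTo N (BigWitt.add f g) (BigWitt.add f' g') := by
  intro k hk
  rw [coeff_add, coeff_add]
  refine Finset.sum_congr rfl fun p hp => ?_
  have := Finset.HasAntidiagonal.mem_antidiagonal.1 hp
  rw [hf _ (by omega), hg _ (by omega)]

theorem EqUpTo.mul {N : ℕ} {f f' g g' : BigWitt A} (hf : EqUpTo N f f') (hg : EqUpTo N g g') :
    EqUpTo N (BigWitt.mul f g) (BigWitt.mul f' g') := by
  intro k hk
  rw [BigWitt.mul, BigWitt.mul, coeff_ofCoeffs, coeff_ofCoeffs]
  congr 3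
  funext i
  rcases i with i | i
  · exact hf _ (by omega)
  · exact hg _ (by omega)

/-- The coefficient of t^k in λ^m f involves a_1, …, a_{km}, so λ^m costs a factor m in precision.
-/
theorem EqUpTo.lam {N m : ℕ} {f f' : BigWitt A} (hf : EqUpTo (N * m) f f') :
    EqUpTo N (BigWitt.lam m f) (BigWitt.lam m f') := by
  intro k hk
  rw [BigWitt.lam, BigWitt.lam, coeff_ofCoeffs, coeff_ofCoeffs]
  congr 3
  funext i
  exact hf _ (i.2.trans_le (Nat.mul_le_mul_right _ hk))

end Split

/-! ### The λ-ring W(E) over an algebraically closed field -/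

section AlgClosed

variable {E : Type*} [Field E] [IsAlgClosed E]

theorem exists_split_eqUpTo (f : BigWitt E) (N : ℕ) : ∃ s, EqUpTo N f (split s) := by
  obtain ⟨s, -, hs⟩ := exists_multiset_esymm_eq f.coeff f.coeff_zero' N
  exact ⟨s, fun k hk => by rw [coeff_split, hs k hk]⟩

theorem mul_comm' (f g : BigWitt E) : mul f g = mul g f := by
  refine eq_of_forall_eqUpTo fun N => ?_
  obtain ⟨s, hs⟩ := f.exists_split_eqUpTo N
  obtain ⟨t, ht⟩ := g.exists_split_eqUpTo N
  refine (hs.mul ht).trans (EqUpTo.trans ?_ (ht.mul hs).symm)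
  rw [← split_pairProds, ← split_pairProds, pairProds_comm]
  exact .refl _

theorem mul_assoc' (f g h : BigWitt E) : mul (mul f g) h = mul f (mul g h) := by
  refine eq_of_forall_eqUpTo fun N => ?_
  obtain ⟨s, hs⟩ := f.exists_split_eqUpTo N
  obtain ⟨t, ht⟩ := g.exists_split_eqUpTo N
  obtain ⟨u, hu⟩ := h.exists_split_eqUpTo N
  refine ((hs.mul ht).mul hu).trans (EqUpTo.trans ?_ (hs.mul (ht.mul hu)).symm)
  simp only [← split_pairProds, pairProds_assoc]
  exact .refl _

theorem right_distrib' (f g h : BigWitt E) : mul (add f g) h = add (mul f h) (mul g h) := by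
  refine eq_of_forall_eqUpTo fun N => ?_
  obtain ⟨s, hs⟩ := f.exists_split_eqUpTo N
  obtain ⟨t, ht⟩ := g.exists_split_eqUpTo N
  obtain ⟨u, hu⟩ := h.exists_split_eqUpTo N
  refine ((hs.add ht).mul hu).trans (EqUpTo.trans ?_ ((hs.mul hu).add (ht.mul hu)).symm)
  simp only [← split_pairProds, ← split_add, pairProds_add_left]
  exact .refl _

theorem one_mul' (f : BigWitt E) : mul one f = f := by
  refine eq_of_forall_eqUpTo fun N => ?_
  obtain ⟨s, hs⟩ := f.exists_split_eqUpTo N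
  refine ((EqUpTo.refl one).mul hs).trans (EqUpTo.trans ?_ hs.symm)
  rw [← split_one, ← split_pairProds, ← Multiset.cons_zero, pairProds_cons, pairProds_zero]
  simpa using EqUpTo.refl _

theorem zero_mul' (f : BigWitt E) : mul zero f = zero := by
  refine eq_of_forall_eqUpTo fun N => ?_
  obtain ⟨s, hs⟩ := f.exists_split_eqUpTo N
  refine ((EqUpTo.refl zero).mul hs).trans ?_
  rw [← split_zero, ← split_pairProds, pairProds_zero]
  exact .refl _

theorem lam_zero' (f : BigWitt E) : lam 0 f = one := by
  refine eq_of_forall_eqUpTo fun N => ?_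
  obtain ⟨s, hs⟩ := f.exists_split_eqUpTo (N * 0)
  refine hs.lam.trans ?_
  rw [← split_subsetProds, ← split_one]
  simpa [subsetProds] using EqUpTo.refl _

theorem lam_one' (f : BigWitt E) : lam 1 f = f := by
  refine eq_of_forall_eqUpTo fun N => ?_
  obtain ⟨s, hs⟩ := f.exists_split_eqUpTo N
  refine (EqUpTo.lam (by simpa using hs)).trans (EqUpTo.trans ?_ hs.symm)
  rw [← split_subsetProds]
  simpa [subsetProds, Multiset.powersetCard_one] using EqUpTo.refl _

/-- The additive laws are those of multiplication of power series and hold directly; the laws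
involving the Witt product come from approximation by products of linear factors. -/
noncomputable instance : CommRing (BigWitt E) where
  add := add
  zero := zero
  mul := mul
  one := one
  neg := neg
  nsmul := @nsmulRec _ ⟨zero⟩ ⟨add⟩
  zsmul := @zsmulRec _ ⟨zero⟩ ⟨add⟩ ⟨neg⟩ (@nsmulRec _ ⟨zero⟩ ⟨add⟩)
  add_assoc f g h := Subtype.ext (mul_assoc f.1 g.1 h.1)
  zero_add f := Subtype.ext (one_mul f.1)
  add_zero f := Subtype.ext (mul_one f.1)
  add_comm f g := Subtype.ext (mul_comm f.1 g.1)
  neg_add_cancel f := Subtype.ext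
    ((mul_comm _ _).trans (PowerSeries.mul_invOfUnit f.1 1 (by simp [f.2])))
  mul_assoc := mul_assoc'
  mul_comm := mul_comm'
  one_mul := one_mul'
  mul_one f := (mul_comm' _ _).trans (one_mul' f)
  zero_mul := zero_mul'
  mul_zero f := (mul_comm' _ _).trans (zero_mul' f)
  right_distrib := right_distrib'
  left_distrib f g h := by
    change mul f (add g h) = add (mul f g) (mul f h)
    rw [mul_comm', right_distrib', mul_comm' g, mul_comm' h]

/-- The element `1 + a t` of `W(E)`. -/
noncomputable def line (a : E) : BigWitt E := split {a}

theorem split_eq_sum_line (s : Multiset E) : split s = (s.map line).sum := by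
  induction s using Multiset.induction_on with
  | empty => exact split_zero
  | cons a s ih =>
    rw [Multiset.map_cons, Multiset.sum_cons, ← ih, ← Multiset.singleton_add]
    exact split_add _ _

/-- The multiplicative map `a ↦ 1 + a t`. -/
noncomputable def lineHom : E →* BigWitt E where
  toFun := line
  map_one' := split_one
  map_mul' a b := by
    change split {a * b} = mul (split {a}) (split {b})
    rw [← split_pairProds, ← Multiset.cons_zero a, pairProds_cons, pairProds_zero]
    simp

/-- Since a ↦ 1 + a t is multiplicative, the line of a product of members of s is the product of
their lines; summing over n-element subsets gives e_n computed in W(E). -/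
theorem lam_split (n : ℕ) (s : Multiset E) : lam n (split s) = (s.map line).esymm n := by
  have h := subsetProds_map lineHom s n
  rw [← split_subsetProds, split_eq_sum_line]
  exact congrArg Multiset.sum h.symm

theorem eqUpTo_aeval {N : ℕ} {σ : Type*} {u v : σ → BigWitt E}
    (h : ∀ i, EqUpTo N (u i) (v i)) (p : MvPolynomial σ ℤ) :
    EqUpTo N (aeval u p) (aeval v p) :=
  aeval_rel (EqUpTo N) EqUpTo.refl (fun _ _ _ _ h₁ h₂ => EqUpTo.add h₁ h₂)
    (fun _ _ _ _ h₁ h₂ => EqUpTo.mul h₁ h₂) h p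

theorem eqUpTo_sum {N : ℕ} {κ : Type*} (s : Finset κ) {u v : κ → BigWitt E}
    (h : ∀ i ∈ s, EqUpTo N (u i) (v i)) : EqUpTo N (∑ i ∈ s, u i) (∑ i ∈ s, v i) := by
  classical
  induction s using Finset.induction_on with
  | empty => exact .refl _
  | insert a s ha ih =>
    rw [Finset.sum_insert ha, Finset.sum_insert ha]
    exact EqUpTo.add (h a (Finset.mem_insert_self a s))
      (ih fun i hi => h i (Finset.mem_insert_of_mem hi))

theorem lam_add' (n : ℕ) (f g : BigWitt E) : lam n (f + g) =
    ∑ p ∈ Finset.HasAntidiagonal.antidiagonal n, lam p.1 f * lam p.2 g := by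
  refine eq_of_forall_eqUpTo fun N => ?_
  -- Precision N·n serves every λ^i with i ≤ n occurring on either side.
  obtain ⟨s, hs⟩ := f.exists_split_eqUpTo (N * n)
  obtain ⟨t, ht⟩ := g.exists_split_eqUpTo (N * n)
  refine (EqUpTo.lam (hs.add ht)).trans (EqUpTo.trans ?_
    (eqUpTo_sum (v := fun p => lam p.1 (split s) * lam p.2 (split t)) _ fun p hp => ?_).symm)
  · rw [← split_add, lam_split, Multiset.map_add, esymm_add]
    simp only [lam_split]
    exact .refl _
  · have := Finset.HasAntidiagonal.mem_antidiagonal.1 hp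
    exact EqUpTo.mul (EqUpTo.lam (hs.mono (Nat.mul_le_mul_left _ (by omega))))
      (EqUpTo.lam (ht.mono (Nat.mul_le_mul_left _ (by omega))))

/-- On products of linear factors, `lam_split` turns this into the defining identity of P_n for two
families of line elements, that is, `aeval_esymm_prodPoly` over the ring W(E). -/
theorem lam_mul' (n : ℕ) (f g : BigWitt E) : lam n (f * g) =
    aeval (Sum.elim (fun i : Fin n => lam (i + 1) f) (fun j : Fin n => lam (j + 1) g))
      (prodPoly n) := by
  refine eq_of_forall_eqUpTo fun N => ?_
  obtain ⟨s, hs⟩ := f.exists_split_eqUpTo (N * n)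
  obtain ⟨t, ht⟩ := g.exists_split_eqUpTo (N * n)
  refine (EqUpTo.lam (hs.mul ht)).trans (EqUpTo.trans ?_ (eqUpTo_aeval
    (v := Sum.elim (fun i : Fin n => lam (i + 1) (split s))
      (fun j : Fin n => lam (j + 1) (split t))) ?_ _).symm)
  · simp only [lam_split, aeval_esymm_prodPoly]
    rw [← split_pairProds, lam_split]
    have := pairProds_map (lineHom (E := E)) s t
    exact this ▸ .refl _
  · rintro (i | i)
    · exact EqUpTo.lam (hs.mono (Nat.mul_le_mul_left _ (by omega)))
    · exact EqUpTo.lam (ht.mono (Nat.mul_le_mul_left _ (by omega)))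

theorem lam_lam' (m n : ℕ) (f : BigWitt E) : lam m (lam n f) =
    aeval (fun i : Fin (m * n) => lam (i + 1) f) (compPoly m n) := by
  refine eq_of_forall_eqUpTo fun N => ?_
  -- The outer λ^m needs its argument up to degree N·m, which the inner λ^n computes from f up to
  -- degree N·m·n.
  obtain ⟨s, hs⟩ := f.exists_split_eqUpTo (N * m * n)
  refine (EqUpTo.lam (EqUpTo.lam hs)).trans (EqUpTo.trans ?_ (eqUpTo_aeval
    (v := fun i : Fin (m * n) => lam (i + 1) (split s)) (fun i => ?_) _).symm)
  · simp only [lam_split, aeval_esymm_compPoly]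
    rw [← lam_split, ← split_subsetProds, lam_split]
    have := subsetProds_map (lineHom (E := E)) s n
    exact this ▸ .refl _
  · exact EqUpTo.lam (hs.mono (by rw [mul_assoc]; exact Nat.mul_le_mul_left _ (by omega)))

theorem lam_line (a : E) (n : ℕ) (hn : 1 < n) : lam n (line a) = 0 := by
  rw [line, ← split_subsetProds, subsetProds, Multiset.powersetCard_eq_empty _ (by simpa using hn)]
  exact split_zero

noncomputable instance : LambdaRing (BigWitt E) where
  lam := lam
  lam_zero := lam_zero'
  lam_one := lam_one'
  lam_add := lam_add'
  lam_unit n hn := by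
    have h := lam_line (1 : E) n hn
    rwa [line, split_one] at h
  lam_mul := lam_mul'
  lam_lam := lam_lam'

theorem isStandard : IsStandard E := ⟨rfl, rfl, fun _ _ => rfl, fun _ _ => rfl, fun _ _ => rfl⟩

theorem isLineElement_line (a : E) : IsLineElement (line a) := lam_line a

end AlgClosed

/-! ### The homomorphism x ↦ ∑ λ^n(x) t^n -/

section LambdaSeries

variable {R : Type*} [CommRing R] [LambdaRing R] {E : Type*} [Field E] [IsAlgClosed E]

/-- From 0 + 0 = 0 the λ-series of 0 is idempotent; its constant term is 1, so it is a unit, hence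
equal to 1. -/
theorem lam_succ_zero (n : ℕ) : (LambdaRing.lam (n + 1) (0 : R)) = 0 := by
  have h : PowerSeries.mk (fun n => LambdaRing.lam n (0 : R)) *
      PowerSeries.mk (fun n => LambdaRing.lam n (0 : R)) =
      PowerSeries.mk (fun n => LambdaRing.lam n (0 : R)) := by
    ext n
    have := LambdaRing.lam_add n (0 : R) 0
    rw [add_zero] at this
    simp [PowerSeries.coeff_mul, ← this]
  have hu : IsUnit (PowerSeries.mk (fun n => LambdaRing.lam n (0 : R))) := by
    rw [PowerSeries.isUnit_iff_constantCoeff]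
    simp [LambdaRing.lam_zero, ← PowerSeries.coeff_zero_eq_constantCoeff_apply]
  have h1 := hu.mul_left_cancel (h.trans (mul_one _).symm)
  simpa [PowerSeries.coeff_one] using congrArg (PowerSeries.coeff (n + 1)) h1

theorem coeff_zero_eq (n : ℕ) : (0 : BigWitt E).coeff n = if n = 0 then 1 else 0 :=
  PowerSeries.coeff_one n

/-- The homomorphism `x ↦ ∑ λ^n(x) t^n` from a `λ`-ring `R` to `W(E)`,
given a ring homomorphism from `R` to `E`. -/
noncomputable def lamSeries (φ : R →+* E) : R →+* BigWitt E where
  toFun x := ofCoeffs fun n => φ (LambdaRing.lam n x)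
  map_one' := by
    refine ext_coeff fun n => ?_
    change _ = coeff n one
    rw [coeff_ofCoeffs]
    rcases n with _ | _ | n
    · rw [coeff_zero']; simp
    · simp [LambdaRing.lam_one, coeff, one, PowerSeries.coeff_one]
    · simp [LambdaRing.lam_unit, coeff, one, PowerSeries.coeff_one, PowerSeries.coeff_X]
  map_mul' x y := by
    refine ext_coeff fun n => ?_
    change _ = coeff n (mul _ _)
    rw [mul, coeff_ofCoeffs, coeff_ofCoeffs]
    congr 1
    rw [LambdaRing.lam_mul, ringHom_aeval_int]
    congr 2
    funext i
    rcases i with i | i <;> simp [coeff_ofCoeffs]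
  map_zero' := by
    refine ext_coeff fun n => ?_
    rw [coeff_ofCoeffs, coeff_zero_eq]
    rcases n with _ | n
    · rfl
    · simp [lam_succ_zero]
  map_add' x y := by
    refine ext_coeff fun n => ?_
    change _ = coeff n (add _ _)
    have h : ∀ (z : R) n, (ofCoeffs fun n => φ (LambdaRing.lam n z)).coeff n =
        φ (LambdaRing.lam n z) := by
      intro z n
      rw [coeff_ofCoeffs]; split_ifs with h0
      · rw [h0, LambdaRing.lam_zero, map_one]
      · rfl
    simp only [coeff_add, h]
    rw [LambdaRing.lam_add, map_sum]
    simp only [map_mul]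

theorem coeff_lamSeries (φ : R →+* E) (x : R) (n : ℕ) :
    (lamSeries φ x).coeff n = φ (LambdaRing.lam n x) := by
  change (ofCoeffs fun n => φ (LambdaRing.lam n x)).coeff n = _
  rw [coeff_ofCoeffs]; split_ifs with h0
  · rw [h0, LambdaRing.lam_zero, map_one]
  · rfl

theorem lamSeries_injective {φ : R →+* E} (hφ : Function.Injective φ) :
    Function.Injective (lamSeries φ) := by
  intro x y h
  have h1 := congrArg (coeff 1) h
  rw [coeff_lamSeries, coeff_lamSeries, LambdaRing.lam_one, LambdaRing.lam_one] at h1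
  exact hφ h1

theorem lamSeries_lam (φ : R →+* E) (m : ℕ) (x : R) :
    lamSeries φ (LambdaRing.lam m x) = LambdaRing.lam m (lamSeries φ x) := by
  refine ext_coeff fun n => ?_
  change _ = coeff n (lam m _)
  rw [coeff_lamSeries, lam, coeff_ofCoeffs]
  split_ifs with h
  · rw [h, LambdaRing.lam_zero, map_one]
  · rw [LambdaRing.lam_lam, ringHom_aeval_int]
    simp only [coeff_lamSeries]

end LambdaSeries

end BigWitt

/-! ### Rationality of power series from vanishing determinants -/

section Rationality

/-- If the windows (h_k, …, h_{k+N-1}) with k ≥ K spanned E^N, some N of them would form a basis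
with nonzero determinant. So they lie in the kernel of a nonzero linear form, whose coefficients are
the recurrence. -/
theorem exists_linear_recurrence {E : Type*} [Field E] (N : ℕ) (h : ℤ → E) (K : ℤ)
    (hdet : ∀ k : Fin N → ℤ, StrictAnti k → (∀ i, K ≤ k i) →
      Matrix.det (Matrix.of fun i j : Fin N => h (k i + j)) = 0) :
    ∃ c : Fin N → E, c ≠ 0 ∧ ∀ k, K ≤ k → ∑ j : Fin N, h (k + j) * c j = 0 := by
  let v : ℤ → (Fin N → E) := fun k j => h (k + j)
  by_cases hspan : Submodule.span E (v '' Set.Ici K) = ⊤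
  · exfalso
    let B := Module.Basis.ofSpan hspan.ge
    let b := B.reindex (B.indexEquiv (Pi.basisFun E (Fin N)))
    have hb : ∀ i, ∃ k, K ≤ k ∧ v k = b i := by
      intro i
      have h1 : b i ∈ Set.range B := by simp [b]
      obtain ⟨k, hk, hk'⟩ := Module.Basis.ofSpan_subset hspan.ge h1
      exact ⟨k, hk, hk'⟩
    choose k hkK hkv using hb
    have hinj : Function.Injective k := by
      intro i j hij
      apply b.injective
      rw [← hkv, ← hkv, hij]
    -- The determinant hypothesis concerns decreasing indices only, so the sorted order is reversed.
    let τ : Fin N → Fin N := fun i => Tuple.sort k i.rev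
    have hτ : Function.Injective τ := (Tuple.sort k).injective.comp Fin.rev_injective
    have hanti : StrictAnti fun i => k (τ i) := by
      have h1 : StrictMono (k ∘ Tuple.sort k) :=
        (Tuple.monotone_sort k).strictMono_of_injective (hinj.comp (Tuple.sort k).injective)
      exact fun i j hij => h1 (Fin.rev_lt_rev.2 hij)
    have hli : LinearIndependent E (Matrix.of fun i j : Fin N => h (k (τ i) + j)).row := by
      have h1 := b.linearIndependent.comp τ hτ
      have h2 : (b ∘ τ) = (Matrix.of fun i j : Fin N => h (k (τ i) + j)).row :=
        funext fun i => (hkv (τ i)).symm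
      rwa [h2] at h1
    rw [Matrix.linearIndependent_rows_iff_isUnit, Matrix.isUnit_iff_isUnit_det,
      hdet _ hanti fun i => hkK _] at hli
    exact not_isUnit_zero hli
  · obtain ⟨f, hf0, hf⟩ := Submodule.exists_le_ker_of_lt_top _ (lt_top_iff_ne_top.2 hspan)
    refine ⟨fun j => f (Pi.single j 1), fun h0 => hf0 ?_, fun k hk => ?_⟩
    · apply LinearMap.pi_ext'
      intro i
      ext
      simpa using congrFun h0 i
    · have h1 : f (v k) = 0 := hf (Submodule.subset_span ⟨k, hk, rfl⟩)
      rw [LinearMap.pi_apply_eq_sum_univ] at h1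
      have h2 : ∀ i : Fin N, (fun j => if i = j then (1 : E) else 0) = Pi.single i 1 := by
        intro i
        funext j
        simp [Pi.single_apply, eq_comm]
      simpa [v, h2] using h1

/-- The power of X dividing q also divides p and can be cancelled; as f has constant term 1, the
remaining constant terms agree, and one scalar normalises both. -/
theorem exists_coprime_X_polynomials {E : Type*} [Field E] {f : PowerSeries E}
    (hf : PowerSeries.constantCoeff f = 1) {p q : Polynomial E} (hq : q ≠ 0)
    (h : (p : PowerSeries E) = q * f) : ∃ p' q' : Polynomial E, p'.coeff 0 = 1 ∧ q'.coeff 0 = 1 ∧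
      (p' : PowerSeries E) = q' * f := by
  obtain ⟨q₁, hq₁, hX⟩ := q.exists_eq_pow_rootMultiplicity_mul_and_not_dvd hq 0
  set a := q.rootMultiplicity 0
  rw [Polynomial.C_0, sub_zero] at hq₁ hX
  rw [Polynomial.X_dvd_iff] at hX
  have hp : Polynomial.X ^ a ∣ p := by
    rw [Polynomial.X_pow_dvd_iff]
    have h1 : (PowerSeries.X : PowerSeries E) ^ a ∣ (p : PowerSeries E) := by
      rw [h, hq₁]
      push_cast
      rw [mul_assoc]
      exact dvd_mul_right _ _
    intro d hd
    simpa using PowerSeries.X_pow_dvd_iff.1 h1 d hd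
  obtain ⟨p₁, rfl⟩ := hp
  have h2 : (p₁ : PowerSeries E) = q₁ * f := by
    rw [hq₁] at h
    push_cast at h
    rw [mul_assoc] at h
    exact mul_left_cancel₀ (pow_ne_zero a PowerSeries.X_ne_zero) h
  have h3 : p₁.coeff 0 = q₁.coeff 0 := by
    have := congrArg PowerSeries.constantCoeff h2
    rw [map_mul, hf, mul_one] at this
    simpa [← PowerSeries.coeff_zero_eq_constantCoeff_apply] using this
  refine ⟨Polynomial.C (q₁.coeff 0)⁻¹ * p₁, Polynomial.C (q₁.coeff 0)⁻¹ * q₁, ?_, ?_, ?_⟩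
  · rw [Polynomial.coeff_C_mul, h3, inv_mul_cancel₀ hX]
  · rw [Polynomial.coeff_C_mul, inv_mul_cancel₀ hX]
  · push_cast
    rw [h2, mul_assoc]

theorem exists_esymm_eq_coeff {E : Type*} [Field E] [IsAlgClosed E] (p : Polynomial E)
    (hp : p.coeff 0 = 1) : ∃ s : Multiset E, ∀ n, p.coeff n = s.esymm n := by
  obtain ⟨s, hs, h⟩ := exists_multiset_esymm_eq p.coeff hp p.natDegree
  refine ⟨s, fun n => ?_⟩
  rcases le_or_gt n p.natDegree with hn | hn
  · exact (h n hn).symm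
  · rw [Polynomial.coeff_eq_zero_of_natDegree_lt hn, esymm_eq_zero_of_card_lt _ _ (hs ▸ hn)]

/-- The recurrence says that the product of ∑ h_n t^n with a suitable polynomial p has no terms of
degree ≥ q, so it is a polynomial r. Multiplying by f, the inverse of ∑ h_n t^n, gives p = r f. -/
theorem exists_polynomial_eq_mul_of_recurrence {E : Type*} [Field E] {N q : ℕ} {h : ℤ → E}
    (hneg : ∀ k < 0, h k = 0) {f : PowerSeries E} (hf : (PowerSeries.mk fun n : ℕ => h n) * f = 1)
    {c : Fin N → E} (hc : c ≠ 0)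
    (hrec : ∀ k : ℤ, (q : ℤ) - (N - 1) ≤ k → ∑ j : Fin N, h (k + j) * c j = 0) :
    ∃ p r : Polynomial E, r ≠ 0 ∧ (p : PowerSeries E) = r * f := by
  -- The coefficients are reversed so that convolution with h produces the window sums of the
  -- recurrence.
  let p : Polynomial E := ∑ j : Fin N, Polynomial.C (c j) * Polynomial.X ^ (N - 1 - j : ℕ)
  have hp : p ≠ 0 := by
    intro h0
    apply hc
    funext i
    have h1 := congrArg (fun p => Polynomial.coeff p (N - 1 - i : ℕ)) h0
    simp only [p, Polynomial.finsetSum_coeff, Polynomial.coeff_C_mul_X_pow] at h1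
    rw [Finset.sum_eq_single i] at h1
    · simpa using h1
    · intro j _ hj
      rw [if_neg]
      have := i.2
      have := j.2
      intro h2
      exact hj (Fin.ext (by omega))
    · simp
  have hcoeff : ∀ M : ℕ, PowerSeries.coeff M
      ((PowerSeries.mk fun n : ℕ => h n) * (p : PowerSeries E)) =
      ∑ j : Fin N, h ((M : ℤ) - (N - 1) + j) * c j := by
    intro M
    have hpc : (p : PowerSeries E) =
        ∑ j : Fin N, PowerSeries.C (c j) * PowerSeries.X ^ (N - 1 - j : ℕ) := by
      rw [← Polynomial.coeToPowerSeries.ringHom_apply, map_sum]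
      simp
    rw [hpc, Finset.mul_sum, map_sum]
    refine Finset.sum_congr rfl fun j _ => ?_
    rw [mul_left_comm, PowerSeries.coeff_C_mul, PowerSeries.coeff_mul_X_pow', mul_comm]
    have := j.2
    split_ifs with hM
    · rw [PowerSeries.coeff_mk]
      congr 2
      omega
    -- Terms missing from the convolution correspond to h at negative indices.
    · rw [hneg _ (by omega)]
  let r : Polynomial E := PowerSeries.trunc q ((PowerSeries.mk fun n : ℕ => h n) * (p : PowerSeries E))
  have hr : (r : PowerSeries E) =
      (PowerSeries.mk fun n : ℕ => h n) * (p : PowerSeries E) := by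
    ext M
    rw [Polynomial.coeff_coe, PowerSeries.coeff_trunc]
    split_ifs with hM
    · rfl
    · rw [hcoeff, hrec _ (by omega)]
  have hpr : (p : PowerSeries E) = r * f := by
    rw [hr]
    linear_combination (-(p : PowerSeries E)) * hf
  refine ⟨p, r, ?_, hpr⟩
  rintro h0
  rw [h0, Polynomial.coe_zero, zero_mul] at hpr
  exact hp (Polynomial.coe_eq_zero_iff.1 hpr)

end Rationality

/-! ### Schur-finite elements as differences of sums of line elements -/

section SchurFinite

theorem completeSym_mul_elemSym : PowerSeries.mk completeSym *
    PowerSeries.mk (fun k => (-1) ^ k * elemSym k) = 1 := by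
  have : PowerSeries.mk completeSym =
      PowerSeries.invOfUnit (PowerSeries.mk fun k => (-1) ^ k * elemSym k) 1 := by
    ext n : 1; simp [completeSym]
  rw [this, mul_comm]
  exact PowerSeries.mul_invOfUnit _ _ (by simp [elemSym])

theorem exists_youngDiagram_rowLen {N : ℕ} (r : Fin N → ℕ) (hr : Antitone r) :
    ∃ μ : YoungDiagram, μ.colLen 0 ≤ N ∧ ∀ i : Fin N, μ.rowLen i = r i := by
  have hmem : ∀ i j, (i, j) ∈ YoungDiagram.ofRowLens (List.ofFn r) hr.sortedGE_ofFn ↔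
      ∃ h : i < N, j < r ⟨i, h⟩ := by
    intro i j
    rw [YoungDiagram.mem_ofRowLens]
    simp
  refine ⟨YoungDiagram.ofRowLens (List.ofFn r) hr.sortedGE_ofFn, ?_, fun i => ?_⟩
  · by_contra! h
    obtain ⟨h', -⟩ := (hmem N 0).1 (YoungDiagram.mem_iff_lt_colLen.2 h)
    exact lt_irrefl _ h'
  · refine eq_of_forall_lt_iff fun j => ?_
    rw [← YoungDiagram.mem_iff_lt_rowLen, hmem]
    simp

/-- With μ_i = k_i + i this is the Jacobi–Trudi determinant of s_μ. Strictly decreasing integers k_i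
make μ_i weakly decreasing, and the lower bound on the k_i makes its N rows at least as long as the
first row of ν; so μ contains the rectangle around ν. -/
theorem det_completeSymInt_eq_zero {E : Type*} [CommRing E] {ψ : SymFun →+* E} {ν : YoungDiagram}
    (hν : ∀ μ, ν ≤ μ → ψ (schur μ) = 0) {N : ℕ} (hN : ν.colLen 0 = N) (k : Fin N → ℤ)
    (hk : StrictAnti k) (hk' : ∀ i, (ν.rowLen 0 : ℤ) - (N - 1) ≤ k i) :
    Matrix.det (Matrix.of fun i j : Fin N => ψ (completeSymInt (k i + j))) = 0 := by
  have hmono : ∀ i j : Fin N, i ≤ j → k j + j ≤ k i + i := by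
    have key : ∀ d : ℕ, ∀ i j : Fin N, (j : ℕ) = i + d → k j + j ≤ k i + i := by
      intro d
      induction d with
      | zero =>
        intro i j hij
        rw [show j = i from Fin.ext hij]
      | succ d ih =>
        intro i j hij
        have hl : (i : ℕ) + d < N := by have := j.2; omega
        have h1 := ih i ⟨i + d, hl⟩ rfl
        have h2 : k j < k ⟨i + d, hl⟩ := hk (Fin.lt_def.2 (by simp; omega))
        push_cast at h1
        rw [hij]
        push_cast
        omega
    intro i j hij
    exact key (j - i) i j (by have := Fin.le_def.1 hij; omega)
  have hlow : ∀ i : Fin N, (ν.rowLen 0 : ℤ) ≤ k i + i := by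
    intro i
    have hi := i.2
    have h1 := hmono i ⟨N - 1, by omega⟩ (Fin.le_def.2 (by simp; omega))
    have h2 := hk' ⟨N - 1, by omega⟩
    push_cast [show 1 ≤ N by omega] at h1
    omega
  obtain ⟨μ, hμN, hμ⟩ := exists_youngDiagram_rowLen (fun i : Fin N => (k i + i).toNat)
    fun i j hij => Int.toNat_le_toNat (hmono i j hij)
  have hle : ν ≤ μ := by
    rintro ⟨i, j⟩ hij
    have h1 : i < N := hN ▸ YoungDiagram.mem_iff_lt_colLen.1
      (ν.up_left_mem le_rfl (Nat.zero_le j) hij)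
    have h2 : j < ν.rowLen 0 := YoungDiagram.mem_iff_lt_rowLen.1
      (ν.up_left_mem (Nat.zero_le i) le_rfl hij)
    refine YoungDiagram.mem_iff_lt_rowLen.2 ?_
    have h3 := hμ ⟨i, h1⟩
    have h4 := hlow ⟨i, h1⟩
    simp only at h3 h4
    omega
  have h0 := hν μ hle
  rw [← jt_det_stable μ N hμN, RingHom.map_det] at h0
  convert h0 using 2
  ext i j
  have h3 := hμ i
  have h4 := hlow i
  simp only [Matrix.of_apply, RingHom.mapMatrix_apply, Matrix.map_apply, jt]
  congr 2
  omega

/-- A homomorphism from `Λ` to an algebraically closed field killing all `s_μ` with `μ ⊇ ν` maps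
`∑ e_n t^n` to a quotient of two products of linear factors. -/
theorem exists_esymm_eq_of_schur_eq_zero {E : Type*} [Field E] [IsAlgClosed E] (ψ : SymFun →+* E)
    {ν : YoungDiagram} (hν : ∀ μ, ν ≤ μ → ψ (schur μ) = 0) :
    ∃ s t : Multiset E, ∀ n, s.esymm n =
      ∑ p ∈ Finset.HasAntidiagonal.antidiagonal n, ψ (elemSym p.1) * t.esymm p.2 := by
  obtain ⟨c, hc, hrec⟩ := exists_linear_recurrence (ν.colLen 0)
    (fun k => ψ (completeSymInt k)) _ (det_completeSymInt_eq_zero hν rfl)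
  have hf := congrArg (PowerSeries.map ψ) completeSym_mul_elemSym
  rw [map_mul, map_one] at hf
  obtain ⟨p, r, hr, hpr⟩ := exists_polynomial_eq_mul_of_recurrence
    (h := fun k => ψ (completeSymInt k)) (fun k hk => by simp [completeSymInt, hk])
    (f := PowerSeries.map ψ (PowerSeries.mk fun k => (-1) ^ k * elemSym k))
    (by
      rw [← hf]
      congr 1) hc hrec
  obtain ⟨p, r, hp0, hr0, hpr⟩ := exists_coprime_X_polynomials
    (by simp [← PowerSeries.coeff_zero_eq_constantCoeff_apply, elemSym]) hr hpr
  obtain ⟨s, hs⟩ := exists_esymm_eq_coeff p hp0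
  obtain ⟨t, ht⟩ := exists_esymm_eq_coeff r hr0
  -- The inverse of ∑ h_n t^n is ∑ e_n (-t)^n; negating both multisets replaces -t by t.
  refine ⟨s.map Neg.neg, t.map Neg.neg, fun n => ?_⟩
  have h := congrArg (PowerSeries.coeff n) hpr
  rw [mul_comm, PowerSeries.coeff_mul, Polynomial.coeff_coe, hs] at h
  rw [Multiset.esymm_neg, h, Finset.mul_sum]
  refine Finset.sum_congr rfl fun i hi => ?_
  rw [← Finset.HasAntidiagonal.mem_antidiagonal.1 hi, Multiset.esymm_neg, Polynomial.coeff_coe, ht,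
    PowerSeries.coeff_map, PowerSeries.coeff_mk, map_mul, map_pow, map_neg, map_one, pow_add]
  have h1 : ((-1 : E) ^ i.1) * (-1) ^ i.1 = 1 := by rw [← mul_pow]; simp
  linear_combination ((-1) ^ i.2 * ψ (elemSym i.1) * t.esymm i.2) * h1

theorem symOp_elemSym {R : Type*} [CommRing R] [LambdaRing R] (n : ℕ) (x : R) :
    symOp (elemSym n) x = LambdaRing.lam n x := by
  rcases n with _ | n
  · simp [symOp, elemSym, LambdaRing.lam_zero]
  · simp [symOp, elemSym]

namespace BigWitt

theorem lamSeries_eq_split_sub_split {R : Type*} [CommRing R] [LambdaRing R] {E : Type*} [Field E]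
    [IsAlgClosed E] (φ : R →+* E) {x : R} (hx : IsSchurFinite x) :
    ∃ s t : Multiset E, lamSeries φ x = split s - split t := by
  obtain ⟨ν, hν⟩ := hx
  obtain ⟨s, t, h⟩ := exists_esymm_eq_of_schur_eq_zero (ν := ν)
    -- This is evaluation of symmetric functions at x followed by φ, so it sends e_n to the n-th
    -- coefficient of the λ-series.
    (φ.comp (aeval fun k => LambdaRing.lam (k + 1) x : SymFun →ₐ[ℤ] R).toRingHom)
    (fun μ hμ => (congrArg φ (hν μ hμ)).trans (map_zero φ))
  refine ⟨s, t, eq_sub_of_add_eq (ext_coeff fun n => ?_)⟩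
  change coeff n (add _ _) = _
  rw [coeff_add, coeff_split, h]
  refine Finset.sum_congr rfl fun p _ => ?_
  rw [coeff_lamSeries, coeff_split, ← symOp_elemSym]
  rfl

theorem exists_split_eq_sum {E : Type*} [Field E] [IsAlgClosed E] (s : Multiset E) :
    ∃ (p : ℕ) (l : Fin p → BigWitt E), (∀ i, IsLineElement (l i)) ∧ split s = ∑ i, l i := by
  obtain ⟨x, hx⟩ := exists_eq_univ_map s
  refine ⟨s.card, fun i => line (x i), fun i => isLineElement_line _, ?_⟩
  rw [split_eq_sum_line]
  conv_lhs => rw [hx, Multiset.map_map]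
  rfl

end BigWitt

end SchurFinite

end LambdaTheory

theorem mainTheorem5 (R : Type*) [CommRing R] [IsDomain R] [LambdaTheory.LambdaRing R] :
    ∃ (_ : CommRing (LambdaTheory.BigWitt (AlgebraicClosure (FractionRing R))))
      (_ : LambdaTheory.LambdaRing (LambdaTheory.BigWitt (AlgebraicClosure (FractionRing R)))),
      LambdaTheory.BigWitt.IsStandard (AlgebraicClosure (FractionRing R)) ∧
      ∃ ι : R →+* LambdaTheory.BigWitt (AlgebraicClosure (FractionRing R)),
        Function.Injective ι ∧
        (∀ (n : ℕ) (x : R), ι (LambdaTheory.LambdaRing.lam n x) =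
          LambdaTheory.LambdaRing.lam n (ι x)) ∧
        (∀ (n : ℕ) (x : R), (ι x).coeff n =
          algebraMap R (AlgebraicClosure (FractionRing R)) (LambdaTheory.LambdaRing.lam n x)) ∧
        ∀ x : R, LambdaTheory.IsSchurFinite x →
          ∃ (p q : ℕ) (l : Fin p → LambdaTheory.BigWitt (AlgebraicClosure (FractionRing R)))
            (l' : Fin q → LambdaTheory.BigWitt (AlgebraicClosure (FractionRing R))),
            (∀ i, LambdaTheory.IsLineElement (l i)) ∧
            (∀ j, LambdaTheory.IsLineElement (l' j)) ∧
            ι x = ∑ i, l i - ∑ j, l' j := by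
  refine ⟨inferInstance, inferInstance, LambdaTheory.BigWitt.isStandard,
    LambdaTheory.BigWitt.lamSeries (algebraMap R (AlgebraicClosure (FractionRing R))),
    LambdaTheory.BigWitt.lamSeries_injective ?_,
    fun n x => LambdaTheory.BigWitt.lamSeries_lam _ n x,
    fun n x => LambdaTheory.BigWitt.coeff_lamSeries _ x n, fun x hx => ?_⟩
  · rw [IsScalarTower.algebraMap_eq R (FractionRing R) (AlgebraicClosure (FractionRing R))]
    exact (algebraMap (FractionRing R) _).injective.comp
      (IsFractionRing.injective R (FractionRing R))
  · obtain ⟨s, t, h⟩ := LambdaTheory.BigWitt.lamSeries_eq_split_sub_split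
      (algebraMap R (AlgebraicClosure (FractionRing R))) hx
    obtain ⟨p, l, hl, hs⟩ := LambdaTheory.BigWitt.exists_split_eq_sum s
    obtain ⟨q, l', hl', ht⟩ := LambdaTheory.BigWitt.exists_split_eq_sum t
    exact ⟨p, q, l, l', hl, hl', by rw [h, hs, ht]⟩
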